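/- Let $\log=\log_2$. Consider the word-RAM with $w$-bit words and unit-cost instructions: loading a constant, $+,-,\times$, integer division and remainder, bitwise AND/OR/XOR, shifts, indirect load and store, and (conditional) jumps. A program does not depend on $w$. A query $(\ell,\ell')$ is a pair of bit strings, which stand in memory packed into consecutive words; the addresses and bit lengths of the two strings and the number $w$ are given in registers. There are a word-RAM program $P$, natural numbers $T$, $K$ and a real number $C$ such that the following holds for all integers $n\ge 3$ and $W\ge 1$. For every connected undirected graph $G$ on $n$ nodes with integer edge weights in $[1,W]$ there is an assignment of bit strings (labels) $\ell(x)$ to the nodes $x$ of $G$, each of length at most $$\tfrac12\, n\log(2W+1)+C\cdot\frac{n}{\log n}\,\log(2W+1)\,(\log W+\log\log n),$$ such that, for every word length $w\ge K\log(nW)$ and all nodes $x,y$ of $G$, the program $P$ on the query $(\ell(x),\ell(y))$, with no other information about $G$, halts after at most $T$ steps and outputs the weighted distance $\operatorname{dist}_G(x,y)$. Moreover, with the same $P$, $T$ and $K$, there is a function $e(n)=o(n)$ such that every connected unweighted graph on $n\ge 3$ nodes has such labels, of length at most $\frac{\log 3}{2}n+e(n)$ bits, from which $P$ computes the distance of any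 two nodes in at most $T$ steps for every word length $w\ge K\log n$. -/

import Mathlib

namespace DistLabel

/-! ### Weighted graphs -/

/-- Total weight of a walk in a graph with edge weights `wt`. -/
def walkWeight {V : Type*} {G : SimpleGraph V} (wt : Sym2 V → ℕ) {u v : V} (p : G.Walk u v) : ℕ :=
  (p.edges.map wt).sum

/-- Weighted distance: the least weight of a walk from `u` to `v` (`0` if there is none). -/
noncomputable def wdist {V : Type*} (G : SimpleGraph V) (wt : Sym2 V → ℕ) (u v : V) : ℕ :=
  sInf (Set.range fun p : G.Walk u v => walkWeight wt p)

/-! ### The word-RAM -/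

/-- Binary word operations, all modulo `2 ^ w`. -/
inductive Op where
  | add | sub | mul | div | mod | and | or | xor | shl | shr

/-- Semantics of the operations on `w`-bit words, read as unsigned integers.
Division by zero gives `0`, the remainder modulo zero is the dividend, and a shift by at
least `w` places gives `0`. -/
def Op.eval {w : ℕ} : Op → BitVec w → BitVec w → BitVec w
  | .add, a, b => a + b
  | .sub, a, b => a - b
  | .mul, a, b => a * b
  | .div, a, b => a / b
  | .mod, a, b => a % b
  | .and, a, b => a &&& b
  | .or, a, b => a ||| b
  | .xor, a, b => a ^^^ b
  | .shl, a, b => a <<< b.toNat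
  | .shr, a, b => a >>> b.toNat

/-- Instructions. Register names, constants and jump targets are fixed numbers, so that a
program does not depend on the word length. -/
inductive Instr where
  /-- register `d` := the constant `k` -/
  | const (d k : ℕ)
  /-- register `d` := `op` applied to registers `a` and `b` -/
  | bin (op : Op) (d a b : ℕ)
  /-- register `d` := the memory cell whose address is in register `a` -/
  | load (d a : ℕ)
  /-- the memory cell whose address is in register `a` := register `b` -/
  | store (a b : ℕ)
  /-- go to instruction `t` -/
  | jump (t : ℕ)
  /-- go to instruction `t` if register `a` is zero -/
  | jumpZero (a t : ℕ)
  /-- go to instruction `t` if register `a` is less than register `b` -/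
  | jumpLt (a b t : ℕ)

/-- A program is a finite list of instructions. -/
abbrev Program := List Instr

/-- A configuration of the word-RAM with `w`-bit words. -/
structure Config (w : ℕ) where
  pc : ℕ
  reg : ℕ → BitVec w
  mem : BitVec w → BitVec w

/-- Execution of one instruction. -/
def Instr.exec {w : ℕ} (s : Config w) : Instr → Config w
  | .const d k => ⟨s.pc + 1, Function.update s.reg d (BitVec.ofNat w k), s.mem⟩
  | .bin op d a b => ⟨s.pc + 1, Function.update s.reg d (op.eval (s.reg a) (s.reg b)), s.mem⟩
  | .load d a => ⟨s.pc + 1, Function.update s.reg d (s.mem (s.reg a)), s.mem⟩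
  | .store a b => ⟨s.pc + 1, s.reg, Function.update s.mem (s.reg a) (s.reg b)⟩
  | .jump t => ⟨t, s.reg, s.mem⟩
  | .jumpZero a t => ⟨if s.reg a = 0 then t else s.pc + 1, s.reg, s.mem⟩
  | .jumpLt a b t => ⟨if s.reg a < s.reg b then t else s.pc + 1, s.reg, s.mem⟩

/-- One step of the machine. It has halted when the program counter is outside the program, and
a halted configuration does not change any more. -/
def step (P : Program) {w : ℕ} (s : Config w) : Config w :=
  match P[s.pc]? with
  | some i => i.exec s
  | none => s

/-! ### Decoding of labels on the word-RAM -/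

/-- A label is a bit string. -/
abbrev Label := List Bool

/-- The number of `w`-bit words that a bit string occupies. -/
def numWords (w : ℕ) (l : Label) : ℕ := (l.length + w - 1) / w

/-- The `i`-th `w`-bit word of a bit string; its bit of value `2 ^ j` is the bit of the string
at position `i * w + j`, and the string is padded with zeros. -/
def packWord (w : ℕ) (l : Label) (i : ℕ) : BitVec w :=
  BitVec.ofFnLE fun j : Fin w => l.getD (i * w + j) false

/-- The initial configuration for the query `(lx, ly)`: the packed words of `lx`, followed by
those of `ly`, stand in memory from address `0` on, and all further cells are zero. Registers
`0, …, 4` hold the address and the bit length of `lx`, the address and the bit length of `ly`,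
and the word length; the other registers are zero. -/
def initConfig (w : ℕ) (lx ly : Label) : Config w where
  pc := 0
  reg
    | 0 => 0
    | 1 => BitVec.ofNat w lx.length
    | 2 => BitVec.ofNat w (numWords w lx)
    | 3 => BitVec.ofNat w ly.length
    | 4 => BitVec.ofNat w w
    | _ => 0
  mem a :=
    if a.toNat < numWords w lx then packWord w lx a.toNat
    else packWord w ly (a.toNat - numWords w lx)

/-- With word length `w`, the program `P`, given the two labels `lx` and `ly` and nothing else,
halts after at most `T` steps with the number `d` in register `0`. -/
def Decodes (P : Program) (T w : ℕ) (lx ly : Label) (d : ℕ) : Prop :=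
  P.length ≤ ((step P)^[T] (initConfig w lx ly)).pc ∧
    (((step P)^[T] (initConfig w lx ly)).reg 0).toNat = d

end DistLabel

namespace DistLabel

/-! ### Weighted distances -/

section Distance

variable {V : Type*} {G : SimpleGraph V} {wt : Sym2 V → ℕ}

lemma wdist_le_walkWeight {u v : V} (p : G.Walk u v) : wdist G wt u v ≤ walkWeight wt p :=
  Nat.sInf_le ⟨p, rfl⟩

lemma exists_walkWeight_eq_wdist (hG : G.Connected) (wt : Sym2 V → ℕ) (u v : V) :
    ∃ p : G.Walk u v, walkWeight wt p = wdist G wt u v := by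
  obtain ⟨p⟩ := hG.preconnected u v
  exact Nat.sInf_mem (s := Set.range fun p : G.Walk u v => walkWeight wt p) ⟨_, p, rfl⟩

lemma wdist_comm (hG : G.Connected) (wt : Sym2 V → ℕ) (u v : V) :
    wdist G wt u v = wdist G wt v u := by
  have key : ∀ u v, wdist G wt u v ≤ wdist G wt v u := fun u v => by
    obtain ⟨p, hp⟩ := exists_walkWeight_eq_wdist hG wt v u
    refine (wdist_le_walkWeight p.reverse).trans ?_
    rw [← hp, walkWeight, walkWeight, SimpleGraph.Walk.edges_reverse, List.map_reverse,
      List.sum_reverse]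
  exact le_antisymm (key u v) (key v u)

lemma wdist_triangle (hG : G.Connected) (wt : Sym2 V → ℕ) (u v x : V) :
    wdist G wt u x ≤ wdist G wt u v + wdist G wt v x := by
  obtain ⟨p, hp⟩ := exists_walkWeight_eq_wdist hG wt u v
  obtain ⟨q, hq⟩ := exists_walkWeight_eq_wdist hG wt v x
  refine (wdist_le_walkWeight (p.append q)).trans ?_
  rw [← hp, ← hq, walkWeight, walkWeight, walkWeight, SimpleGraph.Walk.edges_append,
    List.map_append, List.sum_append]

lemma wdist_le_of_adj {u v : V} (h : G.Adj u v) : wdist G wt u v ≤ wt s(u, v) := by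
  refine (wdist_le_walkWeight h.toWalk).trans ?_
  simp [walkWeight]

lemma walkWeight_le {W : ℕ} (hW : ∀ e ∈ G.edgeSet, wt e ≤ W) {u v : V} (p : G.Walk u v) :
    walkWeight wt p ≤ p.length * W := by
  have := List.sum_le_card_nsmul (p.edges.map wt) W (by
    intro x hx
    obtain ⟨e, he, rfl⟩ := List.mem_map.1 hx
    exact hW e (p.edges_subset_edgeSet he))
  simpa [walkWeight] using this

lemma wdist_le_card_mul [Fintype V] (hG : G.Connected) {W : ℕ}
    (hW : ∀ e ∈ G.edgeSet, wt e ≤ W) (u v : V) : wdist G wt u v ≤ Fintype.card V * W := by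
  classical
  obtain ⟨p, hp⟩ := (hG.preconnected u v).exists_isPath
  exact (wdist_le_walkWeight p).trans
    ((walkWeight_le hW p).trans (Nat.mul_le_mul_right _ hp.length_lt.le))

lemma wdist_one (hG : G.Connected) (u v : V) : wdist G (fun _ => 1) u v = G.dist u v := by
  have h : ∀ {u v : V} (p : G.Walk u v), walkWeight (fun _ => 1) p = p.length := fun p => by
    simp [walkWeight]
  apply le_antisymm
  · obtain ⟨p, hp⟩ := hG.exists_walk_length_eq_dist u v
    exact (wdist_le_walkWeight p).trans (by rw [h, hp])
  · obtain ⟨p, hp⟩ := exists_walkWeight_eq_wdist hG (fun _ => 1) u v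
    rw [← hp, h]
    exact G.dist_le p

/-- A parent function of a breadth-first tree with root `r`. -/
lemma exists_parent (hG : G.Connected) (r : V) :
    ∃ par : V → V, ∀ v, v ≠ r → G.Adj v (par v) ∧ G.dist r (par v) < G.dist r v := by
  have : ∀ v, ∃ u, v ≠ r → G.Adj v u ∧ G.dist r u < G.dist r v := by
    intro v
    by_cases hv : v = r
    · exact ⟨v, fun h => (h hv).elim⟩
    obtain ⟨p, hp⟩ := hG.exists_walk_length_eq_dist v r
    cases p with
    | nil => exact (hv rfl).elim
    | @cons _ u _ h q =>
      refine ⟨u, fun _ => ⟨h, ?_⟩⟩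
      rw [SimpleGraph.dist_comm, G.dist_comm (u := r) (v := v), ← hp,
        SimpleGraph.Walk.length_cons]
      exact Nat.lt_succ_of_le (G.dist_le q)
  choose par h using this
  exact ⟨par, h⟩

end Distance

/-! ### Partition of a rooted tree into connected clusters -/

section Clusters

variable {V : Type*} [DecidableEq V]

/-- The part of a rooted tree in `D` hangs together at the node `a`: going to parents from a node of
`D`, one stays in `D` until one meets `a`. -/
def HangsAt {V : Type*} (par : V → V) (r a : V) (D : Finset V) : Prop :=
  ∀ v ∈ D, v = a ∨ (v ≠ r ∧ (par v = a ∨ par v ∈ D))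

/-- A set of nodes that hangs at `v` and can be cut off from `S`. -/
structure IsTwig (par : V → V) (r : V) (S : Finset V) (v : V) (D : Finset V) : Prop where
  subset : D ⊆ S
  mem : v ∈ S
  notMem : v ∉ D
  root : r ∉ D
  parent : ∀ u ∈ D, par u = v ∨ par u ∈ D
  down : ∀ u ∈ S, u ≠ r → par u ∈ D → u ∈ D

lemma exists_twig {par : V → V} {r : V} {depth : V → ℕ}
    (hpar : ∀ v, v ≠ r → depth (par v) < depth v) {g : ℕ} {S : Finset V} (hr : r ∈ S)
    (hS : ∀ u ∈ S, u ≠ r → par u ∈ S) (hcard : g + 1 ≤ S.card) (hg : 1 ≤ g) :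
    ∃ v D, IsTwig par r S v D ∧ g ≤ D.card ∧ D.card ≤ 2 * g := by
  have hex : ∃ k, ∃ v D, IsTwig par r S v D ∧ g ≤ D.card ∧ D.card = k := by
    refine ⟨_, r, S.erase r, ⟨S.erase_subset r, hr, by simp, by simp, ?_, ?_⟩, ?_, rfl⟩
    · intro u hu
      obtain ⟨h1, h2⟩ := Finset.mem_erase.1 hu
      by_cases h : par u = r
      · exact Or.inl h
      · exact Or.inr (Finset.mem_erase.2 ⟨h, hS u h2 h1⟩)
    · intro u hu h _
      exact Finset.mem_erase.2 ⟨h, hu⟩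
    · rw [Finset.card_erase_of_mem hr]; omega
  classical
  obtain ⟨v, D, hD, hgD, hk⟩ := Nat.find_spec hex
  have hmin : ∀ v' D', IsTwig par r S v' D' → g ≤ D'.card → D.card ≤ D'.card := by
    intro v' D' h1 h2
    rw [hk]
    exact Nat.find_min' hex ⟨v', D', h1, h2, rfl⟩
  refine ⟨v, D, hD, hgD, ?_⟩
  by_contra hbig
  push Not at hbig
  obtain ⟨c, hcD, hc⟩ : ∃ c ∈ D, par c = v := by
    have hne : D.Nonempty := Finset.card_pos.1 (by omega)
    obtain ⟨c, hc, hm⟩ := D.exists_min_image depth hne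
    refine ⟨c, hc, (hD.parent c hc).resolve_right fun h => ?_⟩
    have hcr : c ≠ r := fun h => hD.root (h ▸ hc)
    exact absurd (hm _ h) (by have := hpar c hcr; omega)
  have hcr : c ≠ r := fun h => hD.root (h ▸ hcD)
  -- the nodes of `D` below `c`
  have hsub : ∃ E ⊆ D, c ∈ E ∧ (∀ u ∈ E, u = c ∨ par u ∈ E) ∧ (∀ u ∈ D, par u ∈ E → u ∈ E) := by
    refine ⟨D.filter fun u => ∃ k, par^[k] u = c ∧ ∀ i ≤ k, par^[i] u ∈ D, D.filter_subset _,
      Finset.mem_filter.2 ⟨hcD, 0, rfl, fun i hi => ?_⟩, ?_, ?_⟩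
    · obtain rfl : i = 0 := by omega
      exact hcD
    · intro u hu
      obtain ⟨_, k, hk, hi⟩ := Finset.mem_filter.1 hu
      cases k with
      | zero => exact Or.inl hk
      | succ k =>
        refine Or.inr (Finset.mem_filter.2 ⟨hi 1 (by omega), k, hk, fun i hik => ?_⟩)
        exact hi (i + 1) (by omega)
    · intro u hu hp
      obtain ⟨_, k, hk, hi⟩ := Finset.mem_filter.1 hp
      refine Finset.mem_filter.2 ⟨hu, k + 1, hk, fun i hik => ?_⟩
      cases i with
      | zero => exact hu
      | succ i => exact hi i (by omega)
  obtain ⟨E, hED, hcE, hEpar, hEdown⟩ := hsub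
  have h1 : ¬ g ≤ (D \ E).card := by
    intro h
    have := hmin v (D \ E) ⟨(Finset.sdiff_subset).trans hD.subset, hD.mem,
      fun h => hD.notMem (Finset.mem_sdiff.1 h).1, fun h => hD.root (Finset.mem_sdiff.1 h).1,
      fun u hu => ?_, fun u hu hur hp => ?_⟩ h
    · have := Finset.card_sdiff_add_card_eq_card hED
      have := Finset.card_pos.2 ⟨c, hcE⟩
      omega
    · obtain ⟨hu1, hu2⟩ := Finset.mem_sdiff.1 hu
      rcases hD.parent u hu1 with h | h
      · exact Or.inl h
      · exact Or.inr (Finset.mem_sdiff.2 ⟨h, fun h' => hu2 (hEdown u hu1 h')⟩)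
    · obtain ⟨hp1, hp2⟩ := Finset.mem_sdiff.1 hp
      refine Finset.mem_sdiff.2 ⟨hD.down u hu hur hp1, fun h' => ?_⟩
      rcases hEpar u h' with rfl | h
      · exact hD.notMem (hc ▸ hp1)
      · exact hp2 h
  have h2 : ¬ g ≤ (E.erase c).card := by
    intro h
    have := hmin c (E.erase c) ⟨(Finset.erase_subset _ _).trans (hED.trans hD.subset),
      hD.subset hcD, by simp, fun h => hD.root (hED (Finset.mem_of_mem_erase h)),
      fun u hu => ?_, fun u hu hur hp => ?_⟩ h
    · have := Finset.card_erase_of_mem hcE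
      have := Finset.card_le_card hED
      have := Finset.card_pos.2 ⟨c, hcE⟩
      omega
    · obtain ⟨hu1, hu2⟩ := Finset.mem_erase.1 hu
      have h := (hEpar u hu2).resolve_left hu1
      by_cases h' : par u = c
      · exact Or.inl h'
      · exact Or.inr (Finset.mem_erase.2 ⟨h', h⟩)
    · obtain ⟨hp1, hp2⟩ := Finset.mem_erase.1 hp
      refine Finset.mem_erase.2 ⟨fun h => ?_, hEdown u (hD.down u hu hur (hED hp2)) hp2⟩
      rw [h, hc] at hp2
      exact hD.notMem (hED hp2)
  have := Finset.card_sdiff_add_card_eq_card hED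
  have := Finset.card_erase_of_mem hcE
  omega

/-- The nodes of a rooted tree can be divided into about `n / g` classes of size at most `2 * g`
each of which hangs together. -/
lemma exists_clusters {par : V → V} {r : V} {depth : V → ℕ}
    (hpar : ∀ v, v ≠ r → depth (par v) < depth v) {g : ℕ} (hg : 1 ≤ g) (S : Finset V)
    (hr : r ∈ S) (hS : ∀ u ∈ S, u ≠ r → par u ∈ S) :
    ∃ (m : ℕ) (κ : V → ℕ) (apex : ℕ → V), m * g ≤ S.card + g ∧ (∀ v ∈ S, κ v < m) ∧
      (∀ j, (S.filter fun v => κ v = j).card ≤ 2 * g) ∧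
      ∀ j, HangsAt par r (apex j) (S.filter fun v => κ v = j) := by
  induction hn : S.card using Nat.strong_induction_on generalizing S with
  | _ n ih =>
    by_cases hsmall : S.card ≤ 2 * g
    · refine ⟨1, fun _ => 0, fun _ => r, by omega, by simp,
        fun j => (Finset.card_filter_le _ _).trans hsmall, fun j v hv => ?_⟩
      by_cases h : v = r
      · exact Or.inl h
      · refine Or.inr ⟨h, Or.inr ?_⟩
        obtain ⟨h1, h2⟩ := Finset.mem_filter.1 hv
        exact Finset.mem_filter.2 ⟨hS v h1 h, h2⟩
    · obtain ⟨a, D, hD, hD1, hD2⟩ := exists_twig hpar hr hS (g := g) (by omega) hg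
      have hcard := Finset.card_sdiff_add_card_eq_card hD.subset
      obtain ⟨m, κ, apex, hm, hκ, hsize, hhang⟩ := ih (S \ D).card (by omega) (S \ D)
        (Finset.mem_sdiff.2 ⟨hr, hD.root⟩) (fun u hu hur => by
          obtain ⟨h1, h2⟩ := Finset.mem_sdiff.1 hu
          exact Finset.mem_sdiff.2 ⟨hS u h1 hur, fun h => h2 (hD.down u h1 hur h)⟩) rfl
      have hnew : (S.filter fun v => (if v ∈ D then m else κ v) = m) = D := by
        ext v
        simp only [Finset.mem_filter]
        constructor
        · rintro ⟨h1, h2⟩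
          by_contra h
          rw [if_neg h] at h2
          exact absurd (hκ v (Finset.mem_sdiff.2 ⟨h1, h⟩)) (by omega)
        · intro h
          exact ⟨hD.subset h, if_pos h⟩
      have hold : ∀ j, j ≠ m → (S.filter fun v => (if v ∈ D then m else κ v) = j) =
          (S \ D).filter fun v => κ v = j := by
        intro j hj
        ext v
        simp only [Finset.mem_filter, Finset.mem_sdiff]
        by_cases h : v ∈ D
        · simp [h, hj.symm]
        · simp [h]
      refine ⟨m + 1, fun v => if v ∈ D then m else κ v, fun j => if j = m then a else apex j,
        ?_, ?_, ?_, ?_⟩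
      · rw [add_mul]; omega
      · intro v hv
        dsimp only
        split_ifs with h
        · omega
        · have := hκ v (Finset.mem_sdiff.2 ⟨hv, h⟩)
          omega
      · intro j
        by_cases hj : j = m
        · subst hj; rw [hnew]; exact hD2
        · rw [hold j hj]; exact hsize j
      · intro j
        by_cases hj : j = m
        · subst hj
          simp only [hnew, if_true]
          exact fun v hv => Or.inr ⟨fun h => hD.root (h ▸ hv), hD.parent v hv⟩
        · simp only [hold j hj, if_neg hj]; exact hhang j

end Clusters

section ClusterDistance

variable {V : Type*}

/-- A function that changes by at most `W` between a node and its parent changes by at most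
`W * D.card` within a cluster. -/
lemma HangsAt.abs_sub_le {par : V → V} {r a : V} {D : Finset V} (hD : HangsAt par r a D)
    {depth : V → ℕ} (hpar : ∀ v, v ≠ r → depth (par v) < depth v) {f : V → ℤ} {W : ℕ}
    (hf : ∀ v, v ≠ r → |f v - f (par v)| ≤ W) {v : V} (hv : v ∈ D) :
    |f v - f a| ≤ W * D.card := by
  classical
  have key : ∀ k, ∀ v ∈ D, depth v = k →
      |f v - f a| ≤ W * (D.filter fun u => depth u ≤ depth v).card := by
    intro k
    induction k using Nat.strong_induction_on with
    | _ k ih =>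
      intro v hv hk
      rcases hD v hv with rfl | ⟨hr, h⟩
      · rw [sub_self, abs_zero]; positivity
      · have h1 := hf v hr
        have hcard : 1 + (D.filter fun u => depth u ≤ depth (par v)).card ≤
            (D.filter fun u => depth u ≤ depth v).card := by
          rw [add_comm, ← Finset.card_insert_of_notMem (a := v)]
          · apply Finset.card_le_card
            intro u hu
            rcases Finset.mem_insert.1 hu with rfl | hu
            · exact Finset.mem_filter.2 ⟨hv, le_rfl⟩
            · obtain ⟨h1, h2⟩ := Finset.mem_filter.1 hu
              exact Finset.mem_filter.2 ⟨h1, h2.trans (hpar v hr).le⟩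
          · intro h
            have := (Finset.mem_filter.1 h).2
            have := hpar v hr
            omega
        have hcard' : (W : ℤ) * (1 + (D.filter fun u => depth u ≤ depth (par v)).card) ≤
            W * (D.filter fun u => depth u ≤ depth v).card :=
          mul_le_mul_of_nonneg_left (by exact_mod_cast hcard) (by positivity)
        have hpos : (0 : ℤ) ≤ W * (D.filter fun u => depth u ≤ depth (par v)).card := by
          positivity
        rw [mul_add, mul_one] at hcard'
        rcases h with h | h
        · rw [h] at h1
          omega
        · have h2 := ih _ (hk ▸ hpar v hr) (par v) h rfl
          have h3 := _root_.abs_sub_le (f v) (f (par v)) (f a)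
          omega
  refine (key _ v hv rfl).trans (mul_le_mul_of_nonneg_left ?_ (by positivity))
  exact_mod_cast Finset.card_filter_le _ _

/-- A function on a cluster is determined by its value at the apex and by its differences between
nodes and their parents. -/
lemma HangsAt.eq_of_differences {par : V → V} {r a : V} {D : Finset V} (hD : HangsAt par r a D)
    {depth : V → ℕ} (hpar : ∀ v, v ≠ r → depth (par v) < depth v) {f f' : V → ℤ}
    (ha : f a = f' a) (h : ∀ v ∈ D, v ≠ r → f v - f (par v) = f' v - f' (par v))
    {v : V} (hv : v ∈ D) : f v = f' v := by
  induction hk : depth v using Nat.strong_induction_on generalizing v with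
  | _ k ih =>
    rcases hD v hv with rfl | ⟨hr, h'⟩
    · exact ha
    · have h1 := h v hv hr
      have h2 : f (par v) = f' (par v) := by
        rcases h' with h' | h'
        · rw [h', ha]
        · exact ih _ (hk ▸ hpar v hr) h' rfl
      omega

end ClusterDistance

/-! ### Straight-line programs from formulas -/

/-- Expressions over the registers and the memory. -/
inductive Formula where
  | reg (i : ℕ)
  | const (k : ℕ)
  | bin (op : Op) (e₁ e₂ : Formula)
  | load (e : Formula)

namespace Formula

/-- The value of an expression in a configuration. -/
def eval {w : ℕ} (r : ℕ → BitVec w) (m : BitVec w → BitVec w) : Formula → BitVec w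
  | reg i => r i
  | const k => BitVec.ofNat w k
  | bin op e₁ e₂ => op.eval (e₁.eval r m) (e₂.eval r m)
  | load e => m (e.eval r m)

/-- Only the registers below `b` occur. -/
def UsesBelow (b : ℕ) : Formula → Prop
  | reg i => i < b
  | const _ => True
  | bin _ e₁ e₂ => e₁.UsesBelow b ∧ e₂.UsesBelow b
  | load e => e.UsesBelow b

/-- Instructions that put the value of an expression into register `d` and use only registers from
`d` on for intermediate results. -/
def compile : Formula → ℕ → Program
  | reg i, d => [.bin .or d i i]
  | const k, d => [.const d k]
  | bin op e₁ e₂, d => e₁.compile d ++ (e₂.compile (d + 1) ++ [.bin op d d (d + 1)])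
  | load e, d => e.compile d ++ [.load d d]

end Formula

lemma step_of_getElem? {P : Program} {w : ℕ} {s : Config w} {i : Instr} (h : P[s.pc]? = some i) :
    step P s = i.exec s := by
  unfold step; rw [h]

lemma Op.eval_or_self {w : ℕ} (a : BitVec w) : Op.or.eval a a = a := by
  simp [Op.eval]

lemma Formula.eval_congr {w b : ℕ} {r r' : ℕ → BitVec w} {m : BitVec w → BitVec w} :
    ∀ {e : Formula}, e.UsesBelow b → (∀ i < b, r i = r' i) → e.eval r m = e.eval r' m
  | .reg i, h, hr => hr i h
  | .const _, _, _ => rfl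
  | .bin op e₁ e₂, h, hr => by
    rw [Formula.eval, Formula.eval, eval_congr h.1 hr, eval_congr h.2 hr]
  | .load e, h, hr => congrArg m (eval_congr h hr)

/-- Running the compiled code of an expression inside a larger program. -/
lemma Formula.compile_spec {w b : ℕ} (e : Formula) (he : e.UsesBelow b) (d : ℕ) (hd : b ≤ d)
    (A B : Program) (s : Config w) (hs : s.pc = A.length) :
    ∃ r : ℕ → BitVec w, (step (A ++ (e.compile d ++ B)))^[(e.compile d).length] s =
        ⟨A.length + (e.compile d).length, r, s.mem⟩ ∧
      r d = e.eval s.reg s.mem ∧ ∀ i < d, r i = s.reg i := by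
  induction e generalizing d A B s with
  | reg i =>
    refine ⟨Function.update s.reg d (s.reg i), ?_, by simp [eval], fun j hj => by
      rw [Function.update_of_ne (by omega)]⟩
    simp only [compile, List.length_singleton, Function.iterate_one]
    rw [step_of_getElem? (i := .bin .or d i i) (by simp [hs]), Instr.exec, Op.eval_or_self, hs]
  | const k =>
    refine ⟨Function.update s.reg d (BitVec.ofNat w k), ?_, by simp [eval], fun j hj => by
      rw [Function.update_of_ne (by omega)]⟩
    simp only [compile, List.length_singleton, Function.iterate_one]
    rw [step_of_getElem? (i := .const d k) (by simp [hs]), Instr.exec, hs]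
  | load e ih =>
    obtain ⟨r, h1, h2, h3⟩ := ih he d hd A (.load d d :: B) s hs
    refine ⟨Function.update r d (s.mem (r d)), ?_, by simp [eval, h2], fun j hj => by
      rw [Function.update_of_ne (by omega), h3 j hj]⟩
    have hP : A ++ (compile (.load e) d ++ B) = A ++ (e.compile d ++ Instr.load d d :: B) := by
      simp [compile]
    rw [hP]
    simp only [compile, List.length_append, List.length_singleton]
    rw [add_comm, Function.iterate_add_apply, h1, Function.iterate_one,
      step_of_getElem? (i := .load d d) (by simp), Instr.exec]
    simp; omega
  | bin op e₁ e₂ ih₁ ih₂ =>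
    obtain ⟨r, h1, h2, h3⟩ := ih₁ he.1 d hd A
      (e₂.compile (d + 1) ++ (.bin op d d (d + 1) :: B)) s hs
    obtain ⟨r', h1', h2', h3'⟩ := ih₂ he.2 (d + 1) (by omega) (A ++ e₁.compile d)
      (.bin op d d (d + 1) :: B) ⟨A.length + (e₁.compile d).length, r, s.mem⟩ (by simp)
    refine ⟨Function.update r' d (op.eval (r' d) (r' (d + 1))), ?_, ?_, fun j hj => by
      rw [Function.update_of_ne (by omega), h3' j (by omega)]; exact h3 j hj⟩
    · have hP : A ++ (compile (.bin op e₁ e₂) d ++ B) =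
          A ++ (e₁.compile d ++ (e₂.compile (d + 1) ++ Instr.bin op d d (d + 1) :: B)) := by
        simp [compile]
      have hP' : A ++ (e₁.compile d ++ (e₂.compile (d + 1) ++ Instr.bin op d d (d + 1) :: B)) =
          (A ++ e₁.compile d) ++ (e₂.compile (d + 1) ++ Instr.bin op d d (d + 1) :: B) := by
        simp
      have hlen : (compile (.bin op e₁ e₂) d).length =
          1 + ((e₂.compile (d + 1)).length + (e₁.compile d).length) := by
        simp [compile]; omega
      rw [hP, hlen, Function.iterate_add_apply, Function.iterate_add_apply, h1, hP', h1',
        Function.iterate_one, step_of_getElem? (i := .bin op d d (d + 1))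
          (by
            rw [← List.append_assoc, List.getElem?_append_right (by simp; omega)]
            simp [add_assoc]), Instr.exec]
      simp; omega
    · rw [Function.update_self, h2', h3' d (by omega), eval]
      congr 1
      dsimp only
      exact eval_congr he.2 fun i hi => h3 i (by omega)

/-- The program that evaluates an expression over the input registers. -/
def Formula.program (e : Formula) : Program := e.compile 5 ++ [.bin .or 0 5 5]

lemma Formula.decodes_program {e : Formula} (he : e.UsesBelow 5) {w : ℕ} {lx ly : Label} {d : ℕ}
    (h : (e.eval (initConfig w lx ly).reg (initConfig w lx ly).mem).toNat = d) :
    Decodes e.program e.program.length w lx ly d := by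
  obtain ⟨r, h1, h2, h3⟩ := e.compile_spec he 5 le_rfl [] [.bin .or 0 5 5] (initConfig w lx ly) rfl
  have hfin : (step e.program)^[e.program.length] (initConfig w lx ly) =
      ⟨e.program.length, Function.update r 0 (r 5), (initConfig w lx ly).mem⟩ := by
    have hlen : e.program.length = 1 + (e.compile 5).length := by simp [program, add_comm]
    rw [hlen, Function.iterate_add_apply]
    rw [List.nil_append] at h1
    rw [program, h1, Function.iterate_one, step_of_getElem? (i := .bin .or 0 5 5) (by simp),
      Instr.exec, Op.eval_or_self]
    simp [add_comm]
  rw [Decodes, hfin]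
  exact ⟨le_rfl, by simp [h2, h]⟩

/-! ### Values of expressions as natural numbers -/

namespace Formula

/-- The expression has the value `v` in the given registers and memory. -/
def HasVal {w : ℕ} (r : ℕ → BitVec w) (m : BitVec w → BitVec w) (e : Formula) (v : ℕ) : Prop :=
  (e.eval r m).toNat = v

section

variable {w : ℕ} {r : ℕ → BitVec w} {m : BitVec w → BitVec w} {e e₁ e₂ : Formula} {a b : ℕ}

lemma HasVal.const (h : a < 2 ^ w) : HasVal r m (.const a) a := by
  simp [HasVal, eval, Nat.mod_eq_of_lt h]

lemma HasVal.add (h₁ : HasVal r m e₁ a) (h₂ : HasVal r m e₂ b) (h : a + b < 2 ^ w) :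
    HasVal r m (.bin .add e₁ e₂) (a + b) := by
  unfold HasVal at *
  rw [eval, Op.eval, BitVec.toNat_add, h₁, h₂, Nat.mod_eq_of_lt h]

lemma HasVal.mul (h₁ : HasVal r m e₁ a) (h₂ : HasVal r m e₂ b) (h : a * b < 2 ^ w) :
    HasVal r m (.bin .mul e₁ e₂) (a * b) := by
  unfold HasVal at *
  rw [eval, Op.eval, BitVec.toNat_mul, h₁, h₂, Nat.mod_eq_of_lt h]

lemma HasVal.sub (h₁ : HasVal r m e₁ a) (h₂ : HasVal r m e₂ b) (h : b ≤ a) :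
    HasVal r m (.bin .sub e₁ e₂) (a - b) := by
  unfold HasVal at *
  rw [eval, Op.eval, BitVec.toNat_sub_of_le (by rw [BitVec.le_def, h₁, h₂]; exact h), h₁, h₂]

lemma HasVal.div (h₁ : HasVal r m e₁ a) (h₂ : HasVal r m e₂ b) :
    HasVal r m (.bin .div e₁ e₂) (a / b) := by
  unfold HasVal at *
  rw [eval, Op.eval, BitVec.toNat_udiv, h₁, h₂]

lemma HasVal.mod (h₁ : HasVal r m e₁ a) (h₂ : HasVal r m e₂ b) :
    HasVal r m (.bin .mod e₁ e₂) (a % b) := by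
  unfold HasVal at *
  rw [eval, Op.eval, BitVec.toNat_umod, h₁, h₂]

lemma HasVal.xor (h₁ : HasVal r m e₁ a) (h₂ : HasVal r m e₂ b) :
    HasVal r m (.bin .xor e₁ e₂) (a ^^^ b) := by
  unfold HasVal at *
  rw [eval, Op.eval, BitVec.toNat_xor, h₁, h₂]

lemma HasVal.or (h₁ : HasVal r m e₁ a) (h₂ : HasVal r m e₂ b) :
    HasVal r m (.bin .or e₁ e₂) (a ||| b) := by
  unfold HasVal at *
  rw [eval, Op.eval, BitVec.toNat_or, h₁, h₂]

lemma HasVal.shr (h₁ : HasVal r m e₁ a) (h₂ : HasVal r m e₂ b) :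
    HasVal r m (.bin .shr e₁ e₂) (a >>> b) := by
  unfold HasVal at *
  rw [eval, Op.eval, BitVec.toNat_ushiftRight, h₁, h₂]

lemma HasVal.shl (h₁ : HasVal r m e₁ a) (h₂ : HasVal r m e₂ b) :
    HasVal r m (.bin .shl e₁ e₂) ((a <<< b) % 2 ^ w) := by
  unfold HasVal at *
  rw [eval, Op.eval, BitVec.toNat_shiftLeft, h₁, h₂]

end

end Formula

/-! ### Reading bit fields -/

/-- The `len` bits of `l` from position `pos` on form the number `v`. -/
structure HasField (l : Label) (pos len v : ℕ) : Prop where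
  le : pos + len ≤ l.length
  lt : v < 2 ^ len
  bit : ∀ j < len, l.getD (pos + j) false = v.testBit j

/-- The words of `l` stand in memory from address `base` on. -/
def Holds {w : ℕ} (m : BitVec w → BitVec w) (base : ℕ) (l : Label) : Prop :=
  ∀ (a : BitVec w) (i : ℕ), a.toNat = base + i → i * w < l.length → m a = packWord w l i

lemma testBit_packWord {w : ℕ} (l : Label) (i j : ℕ) (hj : j < w) :
    (packWord w l i).toNat.testBit j = l.getD (i * w + j) false := by
  rw [packWord, BitVec.testBit_toNat, BitVec.getLsbD_ofFnLE]
  simp [hj]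

namespace Formula

/-- The bit field of length `len` at position `pos` of the string at address `base`. -/
def readField (base pos len : Formula) : Formula :=
  .bin .mod
    (.bin .or
      (.bin .shr (.load (.bin .add base (.bin .div pos (.reg 4)))) (.bin .mod pos (.reg 4)))
      (.bin .shl (.load (.bin .add (.bin .add base (.bin .div pos (.reg 4))) (.const 1)))
        (.bin .sub (.reg 4) (.bin .mod pos (.reg 4)))))
    (.bin .shl (.const 1) len)

lemma HasVal.readField {w : ℕ} {r : ℕ → BitVec w} {m : BitVec w → BitVec w} {base pos len : Formula}
    {b p k v : ℕ} {l : Label} (hw : 1 ≤ w) (hr : HasVal r m (.reg 4) w) (hb : HasVal r m base b)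
    (hp : HasVal r m pos p) (hk : HasVal r m len k) (hkw : k < w) (hm : Holds m b l)
    (hbp : b + p / w + 1 < 2 ^ w) (hv : HasField l p k v) :
    HasVal r m (readField base pos len) v := by
  have hone : 1 < 2 ^ w := Nat.one_lt_two_pow (by omega)
  have ho : p % w < w := Nat.mod_lt _ hw
  have hi := hp.div hr
  have hm1 := hp.mod hr
  have ha := hb.add hi (by omega)
  have ha' := ha.add (HasVal.const hone) hbp
  have hpow : (1 <<< k) % 2 ^ w = 2 ^ k := by
    rw [Nat.one_shiftLeft, Nat.mod_eq_of_lt (Nat.pow_lt_pow_right (by omega) hkw)]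
  have hlo : HasVal r m (.load (.bin .add base (.bin .div pos (.reg 4)))) _ := rfl
  have hhi : HasVal r m
      (.load (.bin .add (.bin .add base (.bin .div pos (.reg 4))) (.const 1))) _ := rfl
  have h := ((hlo.shr hm1).or (hhi.shl (hr.sub hm1 ho.le))).mod ((HasVal.const hone).shl hk)
  rw [hpow] at h
  have hpw := Nat.div_add_mod p w
  suffices hval : v = _ by rw [hval]; exact h
  apply Nat.eq_of_testBit_eq
  intro j
  rw [Nat.testBit_mod_two_pow]
  by_cases hj : j < k
  · simp only [hj, decide_true, Bool.true_and, Nat.testBit_or, Nat.testBit_shiftRight,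
      Nat.testBit_mod_two_pow, Nat.testBit_shiftLeft, show j < w by omega]
    rw [← hv.bit j hj]
    have hle := hv.le
    by_cases hjw : p % w + j < w
    · have h1 : m (eval r m (.bin .add base (.bin .div pos (.reg 4)))) = packWord w l (p / w) :=
        hm _ _ ha (by rw [mul_comm]; omega)
      have h2 : decide (j ≥ w - p % w) = false := by simp; omega
      rw [eval, h1, testBit_packWord _ _ _ hjw, h2]
      simp only [Bool.false_and, Bool.or_false]
      congr 1
      rw [mul_comm]; omega
    · have h1 : m (eval r m (.bin .add (.bin .add base (.bin .div pos (.reg 4))) (.const 1))) =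
          packWord w l (p / w + 1) :=
        hm _ _ (by rw [ha', add_assoc]) (by rw [add_mul, mul_comm]; omega)
      have h2 : decide (j ≥ w - p % w) = true := by simp; omega
      have h3 : (eval r m (.load (.bin .add base (.bin .div pos (.reg 4))))).toNat.testBit
          (p % w + j) = false :=
        Nat.testBit_lt_two_pow ((BitVec.isLt _).trans_le
          (Nat.pow_le_pow_right (by omega) (by omega)))
      rw [h3, eval, h1, testBit_packWord _ _ _ (by omega), h2]
      simp only [Bool.true_and, Bool.false_or]
      congr 1
      rw [add_mul, mul_comm]; omega
  · simp only [hj, decide_false, Bool.false_and]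
    exact Nat.testBit_lt_two_pow (hv.lt.trans_le (Nat.pow_le_pow_right (by omega) (by omega)))

end Formula

/-! ### The decoding expression -/

namespace Formula

/-- The number `2 ^ L` for a label whose first `L` bits are zeros followed by a one. -/
def powWidth (base : Formula) : Formula :=
  .bin .add (.bin .xor (.load base) (.bin .sub (.load base) (.const 1))) (.const 1)

/-- The field width `L` of a label, which stands in its second field. -/
def width (base : Formula) : Formula :=
  .bin .mod (.bin .div (.load base) (powWidth base)) (powWidth base)

/-- The field number `k` of a label. -/
def field (base k : Formula) : Formula :=
  readField base (.bin .mul k (width base)) (width base)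

/-- The cyclic distance from the block of the label at `a` to that of the label at `b`. -/
def shift (a b : Formula) : Formula :=
  .bin .mod (.bin .sub (.bin .add (field b (.const 3)) (field a (.const 2))) (field a (.const 3)))
    (field a (.const 2))

/-- The code that the label at `a` holds for the block of the label at `b`. -/
def code (a b : Formula) : Formula :=
  readField a (.bin .add (field a (.const 7)) (shift a b)) (field b (.const 4))

/-- The distance, if the label at `a` holds the block of the label at `b`. -/
def answer (a b : Formula) : Formula :=
  .bin .add (field a (field b (.const 5)))
    (field b (.bin .add (field b (.const 6)) (code a b)))

/-- `0` if the first label holds the block of the second one, `1` otherwise. -/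
def side : Formula :=
  .bin .div (.bin .mul (.const 2) (shift (.reg 0) (.reg 2)))
    (.bin .add (field (.reg 0) (.const 2)) (.const 1))

/-- The distance. -/
def query : Formula :=
  answer (.bin .mul side (.reg 2)) (.bin .mul (.bin .sub (.const 1) side) (.reg 2))

lemma query_usesBelow : query.UsesBelow 5 := by
  have hwidth : ∀ {a : Formula}, a.UsesBelow 5 → (width a).UsesBelow 5 := fun h => by
    simp [width, powWidth, UsesBelow, h]
  have hread : ∀ {a b c : Formula}, a.UsesBelow 5 → b.UsesBelow 5 → c.UsesBelow 5 →
      (readField a b c).UsesBelow 5 := fun h1 h2 h3 => by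
    simp [readField, UsesBelow, h1, h2, h3]
  have hfield : ∀ {a b : Formula}, a.UsesBelow 5 → b.UsesBelow 5 → (field a b).UsesBelow 5 :=
    fun h1 h2 => hread h1 ⟨h2, hwidth h1⟩ (hwidth h1)
  have hheader : ∀ {a : Formula} {k : ℕ}, a.UsesBelow 5 → (field a (.const k)).UsesBelow 5 :=
    fun h1 => hfield h1 trivial
  have hshift : ∀ {a b : Formula}, a.UsesBelow 5 → b.UsesBelow 5 → (shift a b).UsesBelow 5 :=
    fun h1 h2 => ⟨⟨⟨hheader h2, hheader h1⟩, hheader h1⟩, hheader h1⟩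
  have hcode : ∀ {a b : Formula}, a.UsesBelow 5 → b.UsesBelow 5 → (code a b).UsesBelow 5 :=
    fun h1 h2 => hread h1 ⟨hheader h1, hshift h1 h2⟩ (hheader h2)
  have hanswer : ∀ {a b : Formula}, a.UsesBelow 5 → b.UsesBelow 5 → (answer a b).UsesBelow 5 :=
    fun h1 h2 => ⟨hfield h1 (hheader h2), hfield h2 ⟨hheader h2, hcode h1 h2⟩⟩
  have h0 : (Formula.reg 0).UsesBelow 5 := by simp [UsesBelow]
  have h2 : (Formula.reg 2).UsesBelow 5 := by simp [UsesBelow]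
  have hside : side.UsesBelow 5 := ⟨⟨trivial, hshift h0 h2⟩, hheader h0, trivial⟩
  exact hanswer ⟨hside, h2⟩ ⟨⟨trivial, hside⟩, h2⟩

end Formula

/-- The header of a label with fields of width `L`: the period `P` of the cyclic string, the
position `p` and the length `k` of the block of the node, the number `s` of the field with the
approximate distance, the number `t` of the first field of the table, and the position `q` of the
window. -/
structure Header (l : Label) (L P p k s t q : ℕ) : Prop where
  mark : HasField l (0 * L) L (2 ^ (L - 1))
  width : HasField l (1 * L) L L
  period : HasField l (2 * L) L P
  pos : HasField l (3 * L) L p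
  len : HasField l (4 * L) L k
  approx : HasField l (5 * L) L s
  table : HasField l (6 * L) L t
  window : HasField l (7 * L) L q

lemma xor_pred_of_mod {N L : ℕ} (hL : 1 ≤ L) (h : N % 2 ^ L = 2 ^ (L - 1)) :
    (N ^^^ (N - 1)) + 1 = 2 ^ L := by
  have hpos : 0 < 2 ^ (L - 1) := by positivity
  have hN := Nat.div_add_mod N (2 ^ L)
  have hlt : 2 ^ (L - 1) < 2 ^ L := Nat.pow_lt_pow_right (by omega) (by omega)
  rw [h] at hN
  have hN' : N - 1 = 2 ^ L * (N / 2 ^ L) + (2 ^ (L - 1) - 1) := by omega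
  have hx : N ^^^ (N - 1) = 2 ^ L - 1 := by
    rw [hN']
    nth_rewrite 1 [← hN]
    apply Nat.eq_of_testBit_eq
    intro j
    rw [Nat.testBit_xor, Nat.testBit_two_pow_mul_add _ hlt,
      Nat.testBit_two_pow_mul_add _ (by omega), Nat.testBit_two_pow_sub_one]
    by_cases hj : j < L
    · simp only [hj, if_true, Nat.testBit_two_pow, Nat.testBit_two_pow_sub_one, decide_true]
      by_cases hj' : j = L - 1
      · subst hj'; simp
      · have h1 : j < L - 1 := by omega
        simp [h1, Ne.symm hj']
    · simp [hj]
  rw [hx]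
  have : 0 < 2 ^ L := by positivity
  omega

namespace Formula

/-- The expression `e` points at the label `l` with fields of width `L`. -/
structure Points {w : ℕ} (r : ℕ → BitVec w) (m : BitVec w → BitVec w) (L : ℕ) (e : Formula) (b : ℕ)
    (l : Label) : Prop where
  pos : 1 ≤ L
  le : 4 * L ≤ w
  word : HasVal r m (.reg 4) w
  base : HasVal r m e b
  holds : Holds m b l
  base_lt : b < 2 ^ L
  length_lt : l.length < 2 ^ L

variable {w : ℕ} {r : ℕ → BitVec w} {m : BitVec w → BitVec w} {L b : ℕ} {e : Formula} {l : Label}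

lemma Points.four_mul_lt (h : Points r m L e b l) : 4 * 2 ^ L ≤ 2 ^ w := by
  have := h.pos
  have := h.le
  calc 4 * 2 ^ L = 2 ^ (L + 2) := by rw [pow_add]; ring
    _ ≤ 2 ^ w := Nat.pow_le_pow_right (by omega) (by omega)

lemma Points.readField (h : Points r m L e b l) {pos len : Formula} {p k v : ℕ}
    (hp : HasVal r m pos p) (hk : HasVal r m len k) (hkL : k ≤ L) (hv : HasField l p k v) :
    HasVal r m (readField e pos len) v := by
  have h1 := h.pos
  have h2 := h.le
  have h3 := h.four_mul_lt
  have h4 := h.base_lt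
  have h5 := h.length_lt
  have h6 := hv.le
  have h7 := Nat.div_le_self p w
  exact HasVal.readField (by omega) h.word h.base hp hk (by omega) h.holds (by omega) hv

lemma Points.width (h : Points r m L e b l) (hmark : HasField l (0 * L) L (2 ^ (L - 1)))
    (hwidth : HasField l (1 * L) L L) : HasVal r m (width e) L := by
  have hL := h.pos
  have hw := h.le
  have hlt := h.four_mul_lt
  have hpos : 0 < 2 ^ L := by positivity
  have hone : 1 < 2 ^ w := by omega
  have hload : m (e.eval r m) = packWord w l 0 :=
    h.holds _ 0 h.base (by have := hwidth.le; omega)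
  obtain ⟨N, hN⟩ : ∃ N, HasVal r m (.load e) N := ⟨_, rfl⟩
  have hbit : ∀ j < w, N.testBit j = l.getD j false := by
    intro j hj
    rw [← hN, eval, hload, testBit_packWord _ _ _ hj, zero_mul, zero_add]
  have h1 : N % 2 ^ L = 2 ^ (L - 1) := by
    apply Nat.eq_of_testBit_eq
    intro j
    rw [Nat.testBit_mod_two_pow]
    by_cases hj : j < L
    · rw [hbit j (by omega), ← hmark.bit j hj]
      simp [hj]
    · rw [Nat.testBit_lt_two_pow (x := 2 ^ (L - 1))
        (hmark.lt.trans_le (Nat.pow_le_pow_right (by omega) (by omega)))]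
      simp [hj]
  have h2 : N / 2 ^ L % 2 ^ L = L := by
    apply Nat.eq_of_testBit_eq
    intro j
    rw [Nat.testBit_mod_two_pow, Nat.testBit_div_two_pow]
    by_cases hj : j < L
    · rw [hbit _ (by omega), ← hwidth.bit j hj]
      simp [hj, add_comm]
    · rw [Nat.testBit_lt_two_pow (x := L)
        (hwidth.lt.trans_le (Nat.pow_le_pow_right (by omega) (by omega)))]
      simp [hj]
  have hN1 : 1 ≤ N := by
    rcases Nat.eq_zero_or_pos N with rfl | h
    · have : 0 < 2 ^ (L - 1) := by positivity
      simp at h1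
      omega
    · exact h
  have hq := xor_pred_of_mod hL h1
  have h3 := (hN.xor (hN.sub (HasVal.const hone) hN1)).add (HasVal.const hone) (by omega)
  rw [hq] at h3
  have h4 := (hN.div h3).mod h3
  rw [h2] at h4
  exact h4

lemma Points.field (h : Points r m L e b l) (hmark : HasField l (0 * L) L (2 ^ (L - 1)))
    (hwidth : HasField l (1 * L) L L) {k : Formula} {i v : ℕ} (hk : HasVal r m k i)
    (hv : HasField l (i * L) L v) : HasVal r m (field e k) v := by
  have hlt := h.four_mul_lt
  have h1 := hv.le
  have h2 := h.length_lt
  have hL := h.width hmark hwidth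
  exact h.readField (hk.mul hL (by omega)) hL le_rfl hv

lemma Points.header (h : Points r m L e b l) (hmark : HasField l (0 * L) L (2 ^ (L - 1)))
    (hwidth : HasField l (1 * L) L L) {i v : ℕ} (hv : HasField l (i * L) L v) :
    HasVal r m (Formula.field e (.const i)) v := by
  have hlt := h.four_mul_lt
  have h1 := hv.le
  have h2 := h.length_lt
  have h3 := Nat.le_mul_of_pos_right i h.pos
  exact h.field hmark hwidth (HasVal.const (by omega)) hv

variable {e' : Formula} {b' : ℕ} {l' : Label} {P p k s t q p' k' s' t' q' : ℕ}

lemma Points.shift (h : Points r m L e b l) (h' : Points r m L e' b' l')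
    (hl : Header l L P p k s t q) (hl' : Header l' L P p' k' s' t' q') (hp : p < P) :
    HasVal r m (Formula.shift e e') ((p' + P - p) % P) := by
  have hlt := h.four_mul_lt
  have h1 := h.header hl.mark hl.width hl.period
  have h2 := hl.period.lt
  have h3 := hl'.pos.lt
  exact (((h'.header hl'.mark hl'.width hl'.pos).add h1 (by omega)).sub
    (h.header hl.mark hl.width hl.pos) (by omega)).mod h1

/-- The label `l` holds the block of the label `l'`, and the distance is `d`. -/
def Answers (L P p q : ℕ) (l : Label) (p' k' s' t' : ℕ) (l' : Label) (d : ℕ) : Prop :=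
  ∃ c u v, HasField l (q + (p' + P - p) % P) k' c ∧ HasField l (s' * L) L u ∧
    HasField l' ((t' + c) * L) L v ∧ u + v = d

lemma Points.answer (h : Points r m L e b l) (h' : Points r m L e' b' l')
    (hl : Header l L P p k s t q) (hl' : Header l' L P p' k' s' t' q') (hp : p < P) (hk : k' ≤ L)
    {d : ℕ} (ha : Answers L P p q l p' k' s' t' l' d) : HasVal r m (Formula.answer e e') d := by
  obtain ⟨c, u, v, hc, hu, hv, rfl⟩ := ha
  have hlt := h.four_mul_lt
  have h1 := h.shift h' hl hl' hp
  have h2 := h.header hl.mark hl.width hl.window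
  have h3 := hc.le
  have h4 := h.length_lt
  have hcode : HasVal r m (Formula.code e e') c := h.readField (h2.add h1 (by omega))
    (h'.header hl'.mark hl'.width hl'.len) hk hc
  have h5 := hv.le
  have h6 := h'.length_lt
  have h7 := Nat.le_mul_of_pos_right (t' + c) h.pos
  have h8 := h'.field hl'.mark hl'.width
    ((h'.header hl'.mark hl'.width hl'.table).add hcode (by omega)) hv
  have h9 := hu.lt
  have h10 := hv.lt
  exact (h.field hl.mark hl.width (h'.header hl'.mark hl'.width hl'.approx) hu).add h8 (by omega)

end Formula

lemma numWords_le (w : ℕ) (hw : 1 ≤ w) (l : Label) : numWords w l ≤ l.length := by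
  rw [numWords]
  rcases Nat.eq_zero_or_pos l.length with h | h
  · rw [h]
    have : (0 + w - 1) / w = 0 := Nat.div_eq_of_lt (by omega)
    omega
  · rw [Nat.div_le_iff_le_mul hw]
    have := Nat.le_mul_of_pos_right l.length hw
    omega

lemma lt_numWords {w : ℕ} (hw : 1 ≤ w) {l : Label} {i : ℕ} (h : i * w < l.length) :
    i < numWords w l := by
  rw [numWords, Nat.lt_iff_add_one_le, Nat.le_div_iff_mul_le hw, add_mul]
  omega

open DistLabel.Formula in
/-- The decoding program computes the distance of two nodes from labels with the right fields. -/
lemma decodes_of_header {L w P : ℕ} (hL : 1 ≤ L) (hw : 4 * L ≤ w) {lx ly : Label}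
    {px kx sx tx qx py ky sy ty qy d : ℕ} (hx : Header lx L P px kx sx tx qx)
    (hy : Header ly L P py ky sy ty qy) (hlx : lx.length < 2 ^ L) (hly : ly.length < 2 ^ L)
    (hpx : px < P) (hpy : py < P) (hkx : kx ≤ L) (hky : ky ≤ L)
    (hxy : 2 * ((py + P - px) % P) ≤ P → Answers L P px qx lx py ky sy ty ly d)
    (hyx : 2 * ((px + P - py) % P) ≤ P → Answers L P py qy ly px kx sx tx lx d) :
    Decodes query.program query.program.length w lx ly d := by
  apply decodes_program query_usesBelow
  set r := (initConfig w lx ly).reg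
  set m := (initConfig w lx ly).mem with hm
  have hnum := numWords_le w (by omega) lx
  have hpow : 4 * 2 ^ L ≤ 2 ^ w := by
    calc 4 * 2 ^ L = 2 ^ (L + 2) := by rw [pow_add]; ring
      _ ≤ 2 ^ w := Nat.pow_le_pow_right (by omega) (by omega)
  have hpos : 0 < 2 ^ L := by positivity
  have hr0 : HasVal r m (.reg 0) 0 := by simp [HasVal, eval, r, initConfig]
  have hr2 : HasVal r m (.reg 2) (numWords w lx) := by
    simp only [HasVal, eval, r, initConfig, BitVec.toNat_ofNat]
    exact Nat.mod_eq_of_lt (by omega)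
  have hr4 : HasVal r m (.reg 4) w := by
    simp only [HasVal, eval, r, initConfig, BitVec.toNat_ofNat]
    exact Nat.mod_eq_of_lt Nat.lt_two_pow_self
  have hX : Holds m 0 lx := by
    intro a i ha hi
    rw [zero_add] at ha
    simp only [hm, initConfig, ha, if_pos (lt_numWords (by omega) hi)]
  have hY : Holds m (numWords w lx) ly := by
    intro a i ha hi
    simp only [hm, initConfig, ha]
    rw [if_neg (by omega), Nat.add_sub_cancel_left]
  have hPx : ∀ {e : Formula}, HasVal r m e 0 → Points r m L e 0 lx :=
    fun h => ⟨hL, hw, hr4, h, hX, hpos, hlx⟩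
  have hPy : ∀ {e : Formula}, HasVal r m e (numWords w lx) → Points r m L e (numWords w lx) ly :=
    fun h => ⟨hL, hw, hr4, h, hY, by omega, hly⟩
  have hP := hx.period.lt
  have hδ : (py + P - px) % P < P := Nat.mod_lt _ (by omega)
  have hone : HasVal r m (.const 1) 1 := HasVal.const (by omega)
  have hside : HasVal r m side (2 * ((py + P - px) % P) / (P + 1)) :=
    ((HasVal.const (by omega)).mul ((hPx hr0).shift (hPy hr2) hx hy hpx) (by omega)).div
      (((hPx hr0).header hx.mark hx.width hx.period).add hone (by omega))
  by_cases hc : 2 * ((py + P - px) % P) ≤ P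
  · rw [Nat.div_eq_of_lt (by omega)] at hside
    have h1 := hside.mul hr2 (by omega)
    have h2 := (hone.sub hside (by omega)).mul hr2 (by omega)
    rw [zero_mul] at h1
    rw [Nat.sub_zero, one_mul] at h2
    exact (hPx h1).answer (hPy h2) hx hy hpx hky (hxy hc)
  · rw [show 2 * ((py + P - px) % P) / (P + 1) = 1 from
      Nat.div_eq_of_lt_le (by omega) (by omega)] at hside
    have h1 := hside.mul hr2 (by omega)
    have h2 := (hone.sub hside (by omega)).mul hr2 (by omega)
    rw [one_mul] at h1
    rw [Nat.sub_self, zero_mul] at h2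
    refine (hPy h1).answer (hPx h2) hy hx hpy hkx (hyx ?_)
    rcases le_or_gt px py with hle | hlt
    · have h3 : (py + P - px) % P = py - px := by
        rw [show py + P - px = py - px + P by omega, Nat.add_mod_right,
          Nat.mod_eq_of_lt (by omega)]
      rw [h3] at hc
      rw [Nat.mod_eq_of_lt (by omega)]
      omega
    · have h3 : (py + P - px) % P = py + P - px := Nat.mod_eq_of_lt (by omega)
      rw [h3] at hc
      rw [show px + P - py = px - py + P by omega, Nat.add_mod_right,
        Nat.mod_eq_of_lt (by omega)]
      omega

/-! ### Construction of labels -/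

/-- The bit string that consists of `f` fields of width `L` and of `k` further bits. -/
def layout (L f k : ℕ) (fld : ℕ → ℕ) (win : ℕ → Bool) : Label :=
  List.ofFn (n := f * L + k) fun i =>
    if (i : ℕ) < f * L then (fld (i / L)).testBit (i % L) else win (i - f * L)

section Layout

variable {L f k : ℕ} {fld : ℕ → ℕ} {win : ℕ → Bool}

lemma length_layout : (layout L f k fld win).length = f * L + k := by simp [layout]

lemma getD_layout {i : ℕ} (hi : i < f * L + k) : (layout L f k fld win).getD i false =
    if i < f * L then (fld (i / L)).testBit (i % L) else win (i - f * L) := by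
  rw [List.getD_eq_getElem _ _ (by rw [length_layout]; exact hi)]
  simp [layout]

lemma hasField_layout {i v : ℕ} (hi : i < f) (h : fld i = v) (hv : v < 2 ^ L) :
    HasField (layout L f k fld win) (i * L) L v := by
  have hle : i * L + L ≤ f * L := by
    rw [← Nat.succ_mul]; exact Nat.mul_le_mul_right _ hi
  refine ⟨by rw [length_layout]; omega, hv, fun j hj => ?_⟩
  have hL : 0 < L := by omega
  rw [getD_layout (by omega), if_pos (by omega), mul_comm, Nat.mul_add_div hL,
    Nat.div_eq_of_lt hj, Nat.mul_add_mod, Nat.mod_eq_of_lt hj, add_zero, h]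

lemma hasField_window {i n v : ℕ} (hi : i + n ≤ k) (hv : v < 2 ^ n)
    (h : ∀ j < n, win (i + j) = v.testBit j) :
    HasField (layout L f k fld win) (f * L + i) n v := by
  refine ⟨by rw [length_layout]; omega, hv, fun j hj => ?_⟩
  rw [getD_layout (by omega), if_neg (by omega), ← h j hj]
  congr 1
  omega

end Layout

/-- The values of a function can be numbered. -/
lemma exists_code {V α : Type*} [Fintype V] [DecidableEq α] [Inhabited α] (f : V → α) :
    ∃ (c : V → ℕ) (g : ℕ → α), (∀ x, c x < (Finset.univ.image f).card) ∧ ∀ x, g (c x) = f x := by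
  let e := (Finset.univ.image f).equivFin
  have hmem : ∀ x, f x ∈ Finset.univ.image f := fun x =>
    Finset.mem_image_of_mem f (Finset.mem_univ x)
  refine ⟨fun x => e ⟨f x, hmem x⟩,
    fun i => if h : i < (Finset.univ.image f).card then (e.symm ⟨i, h⟩ : α) else default,
    fun x => (e ⟨f x, hmem x⟩).isLt, fun x => ?_⟩
  simp

/-- The start of block number `j` in a sequence of blocks of lengths `len`. -/
def blockStart (len : ℕ → ℕ) (j : ℕ) : ℕ := ∑ i ∈ Finset.range j, len i

lemma blockStart_succ (len : ℕ → ℕ) (j : ℕ) :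
    blockStart len (j + 1) = blockStart len j + len j := Finset.sum_range_succ _ _

lemma blockStart_mono (len : ℕ → ℕ) : Monotone (blockStart len) :=
  monotone_nat_of_le_succ fun j => by rw [blockStart_succ]; omega

/-- Numbers can be written into consecutive blocks of bits. -/
lemma exists_blocks (len c : ℕ → ℕ) :
    ∃ F : ℕ → Bool, ∀ j, ∀ i < len j, F (blockStart len j + i) = (c j).testBit i := by
  classical
  refine ⟨fun a => decide (∃ j, blockStart len j ≤ a ∧ a < blockStart len j + len j ∧
    (c j).testBit (a - blockStart len j) = true), fun j i hi => ?_⟩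
  rw [Bool.eq_iff_iff, decide_eq_true_iff]
  constructor
  · rintro ⟨j', h1, h2, h3⟩
    obtain rfl : j' = j := by
      rcases lt_trichotomy j' j with h | h | h
      · have := blockStart_mono len (show j' + 1 ≤ j from h)
        rw [blockStart_succ] at this
        omega
      · exact h
      · have := blockStart_mono len (show j + 1 ≤ j' from h)
        rw [blockStart_succ] at this
        omega
    rwa [Nat.add_sub_cancel_left] at h3
  · intro h
    exact ⟨j, by omega, by omega, by rwa [Nat.add_sub_cancel_left]⟩

lemma mod_window {P p p' i : ℕ} (hp : p < P) (hi : p' + i < P) :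
    (p + ((p' + P - p) % P + i)) % P = p' + i := by
  rw [← add_assoc, ← Nat.mod_add_mod, Nat.add_mod_mod, show p + (p' + P - p) = p' + P by omega,
    Nat.add_mod_right, Nat.mod_add_mod, Nat.mod_eq_of_lt hi]

/-- The distances from `x` to the nodes of class `j`, relative to an approximate value. -/
def relDist {V : Type*} (d : V → V → ℕ) (κ : V → ℕ) (U : V → ℕ → ℕ) (σ : ℕ → ℕ) (j : ℕ) (x : V) :
    V → ℕ := fun v => if κ v = j then d x v - U x (σ j) else 0

/-- Labels from a partition `κ` of the nodes into classes `j` such that the distances to the nodes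
of a class, relative to one of `m'` approximate values, take at most `N j` values. -/
lemma exists_labels {V : Type*} [Fintype V] [DecidableEq V] {d : V → V → ℕ}
    (hd : ∀ x y, d x y = d y x) {κ : V → ℕ} {m m' : ℕ} (hκ : ∀ v, κ v < m) {σ : ℕ → ℕ}
    (hσ : ∀ v, σ (κ v) < m') {U : V → ℕ → ℕ} (hU : ∀ x y, U x (σ (κ y)) ≤ d x y)
    {N : ℕ → ℕ} (hN : ∀ j, (Finset.univ.image (relDist d κ U σ j)).card ≤ N j)
    {t : ℕ} (hNt : ∀ j, N j ≤ t) {L P M : ℕ}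
    (hP : P = ∑ j ∈ Finset.range m, Nat.clog 2 (N j) + 1)
    (hM : M = (8 + m' + t) * L + (P / 2 + Nat.clog 2 t)) (hL : 2 * M + 2 ≤ 2 ^ L)
    (hdL : ∀ x y, d x y < 2 ^ L) (hL1 : 1 ≤ L) :
    ∃ label : V → Label, (∀ x, (label x).length = M) ∧ ∀ w, 4 * L ≤ w → ∀ x y,
      Decodes Formula.query.program Formula.query.program.length w (label x) (label y) (d x y) := by
  set len : ℕ → ℕ := fun j => Nat.clog 2 (N j) with hlen
  choose c g hc hg using fun j => exists_code (relDist d κ U σ j)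
  choose F hF using fun x => exists_blocks len fun j => c j x
  set pos : V → ℕ := fun x => blockStart len (κ x) with hpos
  set f := 8 + m' + t with hf
  have hfM : f ≤ M := by
    have := Nat.le_mul_of_pos_right f hL1
    omega
  have hlent : ∀ j, len j ≤ Nat.clog 2 t := fun j => Nat.clog_mono_right 2 (hNt j)
  have htL : Nat.clog 2 t ≤ L := Nat.clog_le_of_le_pow (by omega)
  have hposP : ∀ x, pos x + len (κ x) < P := by
    intro x
    have := blockStart_mono len (show κ x + 1 ≤ m from hκ x)
    rw [blockStart_succ] at this
    rw [hP]
    exact Nat.lt_succ_of_le this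
  let header : V → List ℕ := fun x =>
    [2 ^ (L - 1), L, P, pos x, len (κ x), 8 + σ (κ x), 8 + m', f * L]
  let fld : V → ℕ → ℕ := fun x k => if k < 8 then (header x).getD k 0 else
    if k < 8 + m' then U x (k - 8) else g (κ x) (k - (8 + m')) x
  let label : V → Label := fun x => layout L f (P / 2 + Nat.clog 2 t) (fld x)
    fun i => F x ((pos x + i) % P)
  have hlength : ∀ x, (label x).length = M := fun x => by rw [length_layout, hM]
  have hPL : P < 2 ^ L := by omega
  have hheader : ∀ x, Header (label x) L P (pos x) (len (κ x)) (8 + σ (κ x)) (8 + m') (f * L) := by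
    intro x
    have h1 := hposP x
    have h2 := hσ x
    exact ⟨hasField_layout (by omega) rfl (Nat.pow_lt_pow_right (by omega) (by omega)),
      hasField_layout (by omega) rfl Nat.lt_two_pow_self,
      hasField_layout (by omega) rfl hPL,
      hasField_layout (by omega) rfl (by omega),
      hasField_layout (by omega) rfl (by omega),
      hasField_layout (by omega) rfl (by omega),
      hasField_layout (by omega) rfl (by omega),
      hasField_layout (by omega) rfl (by omega)⟩
  have hans : ∀ x y, 2 * ((pos y + P - pos x) % P) ≤ P →
      Formula.Answers L P (pos x) (f * L) (label x)
      (pos y) (len (κ y)) (8 + σ (κ y)) (8 + m') (label y) (d x y) := by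
    intro x y hxy
    have hcN := (hc (κ y) x).trans_le (hN (κ y))
    have hct := hcN.trans_le (hNt (κ y))
    have hσy := hσ y
    have hUd := hU x y
    have hdxy := hdL x y
    have hgc : g (κ y) (c (κ y) x) y = d x y - U x (σ (κ y)) := by
      rw [hg]; simp [relDist]
    refine ⟨c (κ y) x, U x (σ (κ y)), d x y - U x (σ (κ y)), ?_, ?_, ?_, by omega⟩
    · refine hasField_window ?_ (hcN.trans_le (Nat.le_pow_clog (by omega) _)) fun j hj => ?_
      · have := hlent (κ y)
        omega
      · have h1 := hposP x
        have h2 := hposP y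
        rw [mod_window (by omega) (by omega)]
        exact hF x (κ y) j hj
    · refine hasField_layout (by omega) ?_ (by omega)
      simp only [fld]
      rw [if_neg (by omega), if_pos (by omega), Nat.add_sub_cancel_left]
    · refine hasField_layout (by omega) ?_ (by omega)
      simp only [fld]
      rw [if_neg (by omega), if_neg (by omega), Nat.add_sub_cancel_left, hgc]
  refine ⟨label, hlength, fun w hw x y => ?_⟩
  have h1 := hposP x
  have h2 := hposP y
  exact decodes_of_header hL1 hw (hheader x) (hheader y) (by rw [hlength]; omega)
    (by rw [hlength]; omega) (by omega) (by omega) ((hlent _).trans htL) ((hlent _).trans htL)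
    (hans x y) fun h => hd x y ▸ hans y x h

/-! ### Counting the distances to a cluster -/

section Counting

variable {V : Type*} [Fintype V] [DecidableEq V]

lemma card_relDist_le {par : V → V} {r a : V} {depth : V → ℕ}
    (hpar : ∀ v, v ≠ r → depth (par v) < depth v) {d : V → V → ℕ} {W : ℕ}
    (hW : ∀ x v, v ≠ r → |(d x v : ℤ) - d x (par v)| ≤ W) {κ : V → ℕ} {j : ℕ}
    (hj : HangsAt par r a (Finset.univ.filter fun v => κ v = j)) {U : V → ℕ → ℕ} {σ : ℕ → ℕ}
    {R : ℕ} (hU : ∀ x v, κ v = j → U x (σ j) ≤ d x v) (hUa : ∀ x, U x (σ j) ≤ d x a)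
    (haU : ∀ x, d x a ≤ U x (σ j) + 2 * R) :
    (Finset.univ.image (relDist d κ U σ j)).card ≤
      (2 * R + 1) * (2 * W + 1) ^ (Finset.univ.filter fun v => κ v = j).card := by
  set C := Finset.univ.filter fun v => κ v = j with hC
  let key : V → Fin (2 * R + 1) × (C → Fin (2 * W + 1)) := fun x =>
    (⟨d x a - U x (σ j), by have := haU x; omega⟩,
      fun v => ⟨(d x v + W - d x (par v)) % (2 * W + 1), Nat.mod_lt _ (by omega)⟩)
  have hkey : ∀ x x', key x = key x' → relDist d κ U σ j x = relDist d κ U σ j x' := by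
    intro x x' h
    obtain ⟨h1, h2⟩ := Prod.mk.inj h
    have h1 := Fin.mk.inj h1
    funext v
    unfold relDist
    split_ifs with hv
    · have := hj.eq_of_differences hpar (f := fun v => (d x v : ℤ) - U x (σ j))
        (f' := fun v => (d x' v : ℤ) - U x' (σ j))
        (by have := hUa x; have := hUa x'; omega)
        (fun u hu hur => by
          have h3 := Fin.mk.inj (congrFun h2 ⟨u, hu⟩)
          have h4 := abs_le.1 (hW x u hur)
          have h5 := abs_le.1 (hW x' u hur)
          dsimp only at h3
          rw [Nat.mod_eq_of_lt (by omega), Nat.mod_eq_of_lt (by omega)] at h3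
          omega)
        (Finset.mem_filter.2 ⟨Finset.mem_univ v, hv⟩)
      have h3 := hU x v hv
      have h4 := hU x' v hv
      omega
    · rfl
  obtain ⟨f, hf⟩ : ∃ f, relDist d κ U σ j = f ∘ key :=
    ⟨_, (Function.FactorsThrough.extend_comp (g := relDist d κ U σ j) (f := key)
      (fun _ => fun _ => 0) fun x x' h => hkey x x' h).symm⟩
  rw [hf, ← Finset.image_image]
  refine Finset.card_image_le.trans ((Finset.card_le_univ _).trans ?_)
  simp

end Counting

lemma clog_le_logb_add_one {x : ℕ} (hx : 1 ≤ x) : (Nat.clog 2 x : ℝ) ≤ Real.logb 2 x + 1 := by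
  have h := Real.natCeil_logb_natCast 2 x
  rw [← h]
  exact (Nat.ceil_lt_add_one (Real.logb_nonneg (by norm_num) (by exact_mod_cast hx))).le

/-- Labels from a partition into clusters of size about `g` and one into clusters of size about
`g'`, before the choice of the parameters. -/
lemma exists_labels_of_clusters {n W : ℕ} (hn : 1 ≤ n) {G : SimpleGraph (Fin n)}
    {wt : Sym2 (Fin n) → ℕ} (hG : G.Connected) (hwt : ∀ e ∈ G.edgeSet, wt e ≤ W) {g g' : ℕ}
    (hg : 1 ≤ g) (hgg : g ≤ g') {R t : ℕ} (hR : R = 4 * g' * W)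
    (ht : t = (2 * R + 1) * (2 * W + 1) ^ (2 * g)) :
    ∃ (m m' : ℕ) (N : ℕ → ℕ), m * g ≤ n + g ∧ m' * g' ≤ n + g' ∧ (∀ j, N j ≤ t) ∧
      ((∑ j ∈ Finset.range m, Nat.clog 2 (N j) : ℕ) : ℝ) ≤
        m * (1 + Real.logb 2 (2 * R + 1)) + n * Real.logb 2 (2 * W + 1) ∧
      ∀ L P M : ℕ, P = ∑ j ∈ Finset.range m, Nat.clog 2 (N j) + 1 →
        M = (8 + m' + t) * L + (P / 2 + Nat.clog 2 t) → 2 * M + 2 ≤ 2 ^ L →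
        n * W < 2 ^ L → 1 ≤ L →
        ∃ label : Fin n → Label, (∀ x, (label x).length = M) ∧ ∀ w, 4 * L ≤ w → ∀ x y,
          Decodes Formula.query.program Formula.query.program.length w (label x) (label y)
            (wdist G wt x y) := by
  let r : Fin n := ⟨0, hn⟩
  obtain ⟨par, hpar⟩ := exists_parent hG r
  have hdepth : ∀ v, v ≠ r → G.dist r (par v) < G.dist r v := fun v hv => (hpar v hv).2
  set d := wdist G wt with hd
  have hW : ∀ x v, v ≠ r → |(d x v : ℤ) - d x (par v)| ≤ W := by
    intro x v hv
    have hadj := (hpar v hv).1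
    have h0 := (wdist_le_of_adj (wt := wt) hadj).trans (hwt _ hadj)
    have h1 := wdist_triangle hG wt x (par v) v
    have h2 := wdist_triangle hG wt x v (par v)
    rw [wdist_comm hG wt (par v) v] at h1
    rw [abs_le]
    constructor <;> simp only [hd] <;> omega
  obtain ⟨m, κ, apex, hm, hκ, hsize, hhang⟩ := exists_clusters hdepth hg Finset.univ
    (Finset.mem_univ r) (fun _ _ _ => Finset.mem_univ _)
  obtain ⟨m', κ', apex', hm', hκ', hsize', hhang'⟩ := exists_clusters hdepth
    (hg.trans hgg) Finset.univ (Finset.mem_univ r) (fun _ _ _ => Finset.mem_univ _)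
  rw [Finset.card_univ, Fintype.card_fin] at hm hm'
  have hnear : ∀ {κ : Fin n → ℕ} {apex : ℕ → Fin n},
      (∀ j, (Finset.univ.filter fun v => κ v = j).card ≤ 2 * g') →
      (∀ j, HangsAt par r (apex j) (Finset.univ.filter fun v => κ v = j)) →
      ∀ x v, |(d x v : ℤ) - d x (apex (κ v))| ≤ (2 * g' * W : ℕ) := by
    intro κ apex h1 h2 x v
    refine ((h2 (κ v)).abs_sub_le hdepth (hW x)
      (Finset.mem_filter.2 ⟨Finset.mem_univ v, rfl⟩)).trans ?_
    rw [← Nat.cast_mul, mul_comm (2 * g') W]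
    exact_mod_cast Nat.mul_le_mul_left W (h1 _)
  have hnear1 := hnear (fun j => (hsize j).trans (by omega)) hhang
  have hnear2 := hnear hsize' hhang'
  set σ : ℕ → ℕ := fun j => κ' (apex j) with hσ
  set U : Fin n → ℕ → ℕ := fun x s => d x (apex' s) - R with hU
  have hR' : R = 2 * g' * W + 2 * g' * W := by rw [hR]; ring
  have hUle : ∀ x y, U x (σ (κ y)) ≤ d x y := by
    intro x y
    have h1 := abs_le.1 (hnear1 x y)
    have h2 := abs_le.1 (hnear2 x (apex (κ y)))
    simp only [hU, hσ]
    omega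
  set N : ℕ → ℕ := fun j =>
    (2 * R + 1) * (2 * W + 1) ^ (Finset.univ.filter fun v => κ v = j).card with hN
  have hNt : ∀ j, N j ≤ t := fun j => by
    rw [ht]
    exact Nat.mul_le_mul_left _ (Nat.pow_le_pow_right (by omega) (hsize j))
  refine ⟨m, m', N, hm, hm', hNt, ?_, fun L P M hP hM hL hnL hL1 => ?_⟩
  · have hcard : ∑ j ∈ Finset.range m, (Finset.univ.filter fun v => κ v = j).card = n := by
      have := Finset.card_eq_sum_card_fiberwise (s := Finset.univ) (t := Finset.range m) (f := κ)
        (fun v _ => by simpa using hκ v (Finset.mem_univ v))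
      rw [← this, Finset.card_univ, Fintype.card_fin]
    have hterm : ∀ j, (Nat.clog 2 (N j) : ℝ) ≤ (1 + Real.logb 2 (2 * R + 1)) +
        ((Finset.univ.filter fun v => κ v = j).card : ℝ) * Real.logb 2 (2 * W + 1) := by
      intro j
      refine (clog_le_logb_add_one (Nat.mul_pos (by omega) (by positivity))).trans ?_
      push_cast
      rw [Real.logb_mul (by positivity) (by positivity), Real.logb_pow]
      linarith
    push_cast
    calc ∑ j ∈ Finset.range m, (Nat.clog 2 (N j) : ℝ) ≤ ∑ j ∈ Finset.range m,
          ((1 + Real.logb 2 (2 * R + 1)) +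
          ((Finset.univ.filter fun v => κ v = j).card : ℝ) * Real.logb 2 (2 * W + 1)) :=
          Finset.sum_le_sum fun j _ => hterm j
      _ = m * (1 + Real.logb 2 (2 * R + 1)) + n * Real.logb 2 (2 * W + 1) := by
          rw [Finset.sum_add_distrib, ← Finset.sum_mul, Finset.sum_const, Finset.card_range,
            nsmul_eq_mul, ← Nat.cast_sum, hcard]
  · have hN' : ∀ j, (Finset.univ.image (relDist d κ U σ j)).card ≤ N j := by
      intro j
      have hja : ∀ x, (d x (apex' (σ j)) : ℤ) ≤ d x (apex j) + (2 * g' * W : ℕ) ∧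
          (d x (apex j) : ℤ) ≤ d x (apex' (σ j)) + (2 * g' * W : ℕ) := by
        intro x
        have h2 := abs_le.1 (hnear2 x (apex j))
        simp only [hσ]
        omega
      refine card_relDist_le hdepth hW (hhang j) (fun x v hv => hv ▸ hUle x v) ?_ ?_
      · intro x
        have := hja x
        simp only [hU]
        omega
      · intro x
        have := hja x
        simp only [hU]
        omega
    exact exists_labels (wdist_comm hG wt) (fun v => hκ v (Finset.mem_univ v))
      (fun v => hκ' _ (Finset.mem_univ _)) hUle hN' hNt hP hM hL
      (fun x y => lt_of_le_of_lt (by simpa using wdist_le_card_mul hG hwt x y) hnL) hL1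

/-- Labels that contain all distances. -/
lemma exists_labels_of_table {n W : ℕ} {G : SimpleGraph (Fin n)}
    {wt : Sym2 (Fin n) → ℕ} (hG : G.Connected) (hwt : ∀ e ∈ G.edgeSet, wt e ≤ W) {L : ℕ}
    (hL : 2 * ((9 + n) * L) + 2 ≤ 2 ^ L) (hnL : n * W < 2 ^ L) (hL1 : 1 ≤ L) :
    ∃ label : Fin n → Label, (∀ x, (label x).length = (9 + n) * L) ∧ ∀ w, 4 * L ≤ w → ∀ x y,
      Decodes Formula.query.program Formula.query.program.length w (label x) (label y)
        (wdist G wt x y) := by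
  have hconst : ∀ j x, relDist (wdist G wt) (fun v : Fin n => (v : ℕ))
      (fun x s => if h : s < n then wdist G wt x ⟨s, h⟩ else 0) id j x = fun _ => 0 := by
    intro j x
    funext v
    unfold relDist
    split_ifs with h
    · subst h
      simp
    · rfl
  refine exists_labels (m := n) (m' := n) (κ := fun v : Fin n => (v : ℕ)) (σ := id)
    (U := fun x s => if h : s < n then wdist G wt x ⟨s, h⟩ else 0) (N := fun _ => 1) (t := 1)
    (P := 1) (wdist_comm hG wt) (fun v => v.isLt) (fun v => v.isLt) ?_ ?_ (fun _ => le_rfl)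
    (by simp) ?_ hL
    (fun x y => lt_of_le_of_lt (by simpa using wdist_le_card_mul hG hwt x y) hnL) hL1
  · intro x y
    simp
  · intro j
    rw [Finset.card_le_one]
    intro a ha b hb
    obtain ⟨x, -, rfl⟩ := Finset.mem_image.1 ha
    obtain ⟨y, -, rfl⟩ := Finset.mem_image.1 hb
    rw [hconst, hconst]
  · rw [Nat.clog_one_right]
    ring

/-! ### Choice of the parameters -/

/-- The width of the fields of a label. -/
def fieldWidth (n W : ℕ) : ℕ := 16 * (Nat.log 2 (n * W) + 1)

lemma exists_pow_fieldWidth {n W : ℕ} (hn : 3 ≤ n) (hW : 1 ≤ W) :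
    ∃ X, n * W < X ∧ 4 ≤ X ∧ fieldWidth n W ≤ 16 * X ∧ 2 ^ fieldWidth n W = X ^ 16 := by
  have h3 : 3 ≤ n * W := by nlinarith
  have hlog : 1 ≤ Nat.log 2 (n * W) := Nat.log_pos (by norm_num) (by omega)
  refine ⟨2 ^ (Nat.log 2 (n * W) + 1), Nat.lt_pow_succ_log_self (by norm_num) _, ?_, ?_, ?_⟩
  · calc 4 = 2 ^ 2 := rfl
      _ ≤ _ := Nat.pow_le_pow_right (by norm_num) (by omega)
  · exact Nat.mul_le_mul_left _ Nat.lt_two_pow_self.le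
  · rw [fieldWidth, ← pow_mul, mul_comm]

lemma one_le_fieldWidth (n W : ℕ) : 1 ≤ fieldWidth n W := by unfold fieldWidth; omega

lemma mul_lt_pow_fieldWidth {n W : ℕ} (hn : 3 ≤ n) (hW : 1 ≤ W) : n * W < 2 ^ fieldWidth n W := by
  obtain ⟨X, h1, h2, -, h4⟩ := exists_pow_fieldWidth hn hW
  rw [h4]
  exact h1.trans_le (Nat.le_self_pow (by norm_num) X)

lemma table_size_le {n W : ℕ} (hn : 3 ≤ n) (hW : 1 ≤ W) :
    2 * ((9 + n) * fieldWidth n W) + 2 ≤ 2 ^ fieldWidth n W := by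
  obtain ⟨X, h1, h2, h3, h4⟩ := exists_pow_fieldWidth hn hW
  rw [h4]
  have hnX : n < X := lt_of_le_of_lt (Nat.le_mul_of_pos_right n hW) h1
  have h5 : (9 + n) * fieldWidth n W ≤ (4 * X) * (16 * X) := Nat.mul_le_mul (by omega) h3
  have h6 : 4 ^ 4 * X ^ 2 ≤ X ^ 4 * X ^ 2 := Nat.mul_le_mul_right _ (Nat.pow_le_pow_left h2 4)
  have h7 : X ^ 6 ≤ X ^ 16 := Nat.pow_le_pow_right (by omega) (by norm_num)
  have h8 : X ^ 4 * X ^ 2 = X ^ 6 := by ring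
  nlinarith

lemma cluster_size_le {n W m m' t s : ℕ} (hn : 3 ≤ n) (hW : 1 ≤ W) (hm : m ≤ n + 1)
    (hm' : m' ≤ n + 1) (ht : t ≤ 9 * (n * W) ^ 4) (hs : s ≤ m * t) :
    2 * ((8 + m' + t) * fieldWidth n W + ((s + 1) / 2 + Nat.clog 2 t)) + 2 ≤
      2 ^ fieldWidth n W := by
  obtain ⟨X, h1, h2, h3, h4⟩ := exists_pow_fieldWidth hn hW
  rw [h4]
  have hnX : n < X := lt_of_le_of_lt (Nat.le_mul_of_pos_right n hW) h1
  have hpow : ∀ i j, i + 1 = j → 4 * X ^ i ≤ X ^ j := by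
    rintro i _ rfl
    rw [pow_succ, mul_comm]; exact Nat.mul_le_mul_left _ h2
  have htX : t ≤ X ^ 6 := by
    have := Nat.pow_le_pow_left h1.le 4
    have := hpow 4 5 rfl
    have := hpow 5 6 rfl
    omega
  have h5 : (8 + m' + t) * fieldWidth n W ≤ X ^ 7 * X ^ 3 := by
    refine Nat.mul_le_mul ?_ ?_
    · have := hpow 6 7 rfl
      have : X ≤ X ^ 6 := Nat.le_self_pow (by norm_num) X
      omega
    · have := hpow 1 2 rfl
      rw [pow_one] at this
      have := hpow 2 3 rfl
      omega
  have h6 : s ≤ X * X ^ 6 := hs.trans (Nat.mul_le_mul (by omega) htX)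
  have h7 : Nat.clog 2 t ≤ t := Nat.clog_le_of_le_pow Nat.lt_two_pow_self.le
  have h8 : X ^ 7 * X ^ 3 = X ^ 10 := by ring
  have h9 : X * X ^ 6 = X ^ 7 := by ring
  have h10 : X ^ 7 ≤ X ^ 10 := Nat.pow_le_pow_right (by omega) (by norm_num)
  have h11 : X ^ 6 ≤ X ^ 10 := Nat.pow_le_pow_right (by omega) (by norm_num)
  have h12 : X ^ 12 ≤ X ^ 16 := Nat.pow_le_pow_right (by omega) (by norm_num)
  have h15 : X ≤ X ^ 10 := Nat.le_self_pow (by norm_num) X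
  have h13 := hpow 10 11 rfl
  have h14 := hpow 11 12 rfl
  omega

/-- The lower order term of the label length. -/
noncomputable def excess (n W : ℕ) : ℝ :=
  (n : ℝ) / Real.logb 2 n * Real.logb 2 (2 * (W : ℝ) + 1) *
    (Real.logb 2 W + Real.logb 2 (Real.logb 2 n))

section Estimates

variable {n W : ℕ}

lemma three_halves_le_logb (hn : 3 ≤ n) : 3 / 2 ≤ Real.logb 2 n := by
  have hn' : (3 : ℝ) ≤ n := by exact_mod_cast hn
  rw [Real.le_logb_iff_rpow_le (by norm_num) (by positivity)]
  have h : ((2 : ℝ) ^ (3 / 2 : ℝ)) ^ 2 = 8 := by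
    rw [← Real.rpow_natCast, ← Real.rpow_mul (by norm_num)]; norm_num
  have : (0 : ℝ) ≤ 2 ^ (3 / 2 : ℝ) := by positivity
  nlinarith

lemma half_le_logb_logb (hn : 3 ≤ n) : 1 / 2 ≤ Real.logb 2 (Real.logb 2 n) := by
  have h1 := three_halves_le_logb hn
  rw [Real.le_logb_iff_rpow_le (by norm_num) (by linarith)]
  have h : ((2 : ℝ) ^ (1 / 2 : ℝ)) ^ 2 = 2 := by
    rw [← Real.rpow_natCast, ← Real.rpow_mul (by norm_num)]; norm_num
  have : (0 : ℝ) ≤ 2 ^ (1 / 2 : ℝ) := by positivity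
  nlinarith

lemma logb_nonneg_of_one_le (hW : 1 ≤ W) : 0 ≤ Real.logb 2 W :=
  Real.logb_nonneg (by norm_num) (by exact_mod_cast hW)

lemma logb_three_le : Real.logb 2 3 ≤ 2 := by
  rw [Real.logb_le_iff_le_rpow (by norm_num) (by norm_num)]; norm_num

lemma one_le_logb_base (hW : 1 ≤ W) : 1 ≤ Real.logb 2 (2 * (W : ℝ) + 1) := by
  have hW' : (1 : ℝ) ≤ W := by exact_mod_cast hW
  rw [Real.le_logb_iff_rpow_le (by norm_num) (by positivity), Real.rpow_one]; linarith

lemma logb_le_logb_base (hW : 1 ≤ W) : Real.logb 2 W ≤ Real.logb 2 (2 * (W : ℝ) + 1) := by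
  have hW' : (1 : ℝ) ≤ W := by exact_mod_cast hW
  exact Real.logb_le_logb_of_le (by norm_num) (by linarith) (by linarith)

lemma logb_base_le (hW : 1 ≤ W) : Real.logb 2 (2 * (W : ℝ) + 1) ≤ 2 + Real.logb 2 W := by
  have hW' : (1 : ℝ) ≤ W := by exact_mod_cast hW
  calc Real.logb 2 (2 * (W : ℝ) + 1) ≤ Real.logb 2 (3 * W) :=
        Real.logb_le_logb_of_le (by norm_num) (by linarith) (by linarith)
    _ = Real.logb 2 3 + Real.logb 2 W := Real.logb_mul (by norm_num) (by positivity)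
    _ ≤ 2 + Real.logb 2 W := by linarith [logb_three_le]

lemma natLog_le_logb {x : ℕ} : (Nat.log 2 x : ℝ) ≤ Real.logb 2 x := by
  have := Real.natFloor_logb_natCast 2 x
  rcases Nat.eq_zero_or_pos x with rfl | hx
  · simp
  · rw [← this]
    exact Nat.floor_le (Real.logb_nonneg (by norm_num) (by exact_mod_cast hx))

lemma fieldWidth_le (hn : 3 ≤ n) (hW : 1 ≤ W) :
    (fieldWidth n W : ℝ) ≤ 32 * Real.logb 2 ((n : ℝ) * W) := by
  have h1 : (Nat.log 2 (n * W) : ℝ) ≤ Real.logb 2 ((n : ℝ) * W) := by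
    exact_mod_cast natLog_le_logb (x := n * W)
  have h2 : 1 ≤ Real.logb 2 ((n : ℝ) * W) := by
    have hn' : (3 : ℝ) ≤ n := by exact_mod_cast hn
    have hW' : (1 : ℝ) ≤ W := by exact_mod_cast hW
    rw [Real.le_logb_iff_rpow_le (by norm_num) (by positivity), Real.rpow_one]
    nlinarith
  unfold fieldWidth
  push_cast
  linarith

lemma logb_mul_natCast (hn : 3 ≤ n) (hW : 1 ≤ W) :
    Real.logb 2 ((n : ℝ) * W) = Real.logb 2 n + Real.logb 2 W :=
  Real.logb_mul (by positivity) (by positivity)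

lemma table_estimate (hn : 3 ≤ n) (hW : 1 ≤ W) (h : n < (2 * W + 1) ^ 16) :
    (((9 + n) * fieldWidth n W : ℕ) : ℝ) ≤ 1000000000 * excess n W := by
  have h1 := three_halves_le_logb hn
  have h2 := half_le_logb_logb hn
  have h3 := logb_nonneg_of_one_le hW
  have h4 := one_le_logb_base hW
  have h5 := logb_le_logb_base hW
  have h6 := logb_base_le hW
  have h7 := fieldWidth_le hn hW
  rw [logb_mul_natCast hn hW] at h7
  generalize fieldWidth n W = L at *
  have hn' : (3 : ℝ) ≤ n := by exact_mod_cast hn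
  have h8 : Real.logb 2 n ≤ 16 * Real.logb 2 (2 * (W : ℝ) + 1) := by
    have : (n : ℝ) ≤ (2 * (W : ℝ) + 1) ^ 16 := by exact_mod_cast h.le
    have := Real.logb_le_logb_of_le (b := 2) (by norm_num) (by linarith) this
    rwa [Real.logb_pow] at this
  unfold excess
  set ℓ := Real.logb 2 n
  set B := Real.logb 2 (2 * (W : ℝ) + 1)
  set ω := Real.logb 2 (W : ℝ)
  set μ := Real.logb 2 ℓ
  have h9 : ℓ ≤ 64 * (ω + μ) := by linarith
  have h10 : (n : ℝ) * B ≤ 64 * (n / ℓ * B * (ω + μ)) := by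
    have e : (n : ℝ) * B = n / ℓ * B * ℓ := by
      have : ℓ ≠ 0 := by positivity
      field_simp
    rw [e]
    have hpos : 0 ≤ n / ℓ * B := by positivity
    linarith [mul_le_mul_of_nonneg_left h9 hpos]
  push_cast
  calc ((9 : ℝ) + n) * L ≤ (4 * n) * (544 * B) :=
        mul_le_mul (by linarith) (by linarith) (by positivity) (by positivity)
    _ = 2176 * (n * B) := by ring
    _ ≤ 1000000000 * (n / ℓ * B * (ω + μ)) := by
        have : 0 ≤ n / ℓ * B * (ω + μ) := mul_nonneg (by positivity) (by linarith)
        linarith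

/-- Powers of the logarithm are small compared with roots. -/
lemma exists_root (hn : 1 ≤ n) :
    ∃ y : ℝ, 1 ≤ y ∧ y ^ 16 = n ∧ Real.logb 2 n ≤ 16 * y := by
  have hn' : (1 : ℝ) ≤ n := by exact_mod_cast hn
  have hy1 : 1 ≤ (n : ℝ) ^ (1 / 16 : ℝ) := Real.one_le_rpow hn' (by norm_num)
  have hy : ((n : ℝ) ^ (1 / 16 : ℝ)) ^ 16 = n := by
    rw [← Real.rpow_natCast, ← Real.rpow_mul (by positivity)]; norm_num
  refine ⟨_, hy1, hy, ?_⟩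
  set y := (n : ℝ) ^ (1 / 16 : ℝ)
  have hlog : Real.logb 2 y ≤ y := by
    rw [Real.logb_le_iff_le_rpow (by norm_num) (by linarith)]
    have h1 : y < ⌊y⌋₊ + 1 := Nat.lt_floor_add_one y
    have h2 : ((⌊y⌋₊ : ℕ) : ℝ) + 1 ≤ 2 ^ ⌊y⌋₊ := by exact_mod_cast Nat.lt_two_pow_self
    have h3 : (2 : ℝ) ^ ⌊y⌋₊ ≤ 2 ^ y := by
      rw [← Real.rpow_natCast]
      exact Real.rpow_le_rpow_of_exponent_le (by norm_num) (Nat.floor_le (by linarith))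
    linarith
  rw [← hy, Real.logb_pow]
  push_cast
  linarith

lemma div_logb_le_excess (hn : 3 ≤ n) (hW : 1 ≤ W) : (n : ℝ) / Real.logb 2 n ≤ 2 * excess n W := by
  have h1 := three_halves_le_logb hn
  have h2 := half_le_logb_logb hn
  have h3 := logb_nonneg_of_one_le hW
  have h4 := one_le_logb_base hW
  unfold excess
  have hpos : 0 ≤ (n : ℝ) / Real.logb 2 n := by positivity
  have h5 : 1 / 2 ≤ Real.logb 2 (2 * (W : ℝ) + 1) *
      (Real.logb 2 W + Real.logb 2 (Real.logb 2 n)) := by nlinarith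
  have := mul_le_mul_of_nonneg_left h5 hpos
  rw [mul_assoc]
  linarith

set_option maxHeartbeats 1000000 in
lemma cluster_estimate (hn : 3 ≤ n) (hW : 1 ≤ W) (h : (2 * W + 1) ^ 16 ≤ n)
    {g g' R t m m' s : ℕ} (hg : g = Nat.log ((2 * W + 1) ^ 4) n) (hg1 : 1 ≤ g)
    (hg' : g' = (Nat.log 2 n + 1) ^ 2) (hR : R = 4 * g' * W)
    (ht : t = (2 * R + 1) * (2 * W + 1) ^ (2 * g)) (hm : m * g ≤ n + g) (hm' : m' * g' ≤ n + g')
    (hs : (s : ℝ) ≤ m * (1 + Real.logb 2 (2 * R + 1)) + n * Real.logb 2 (2 * W + 1))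
    (htL : Nat.clog 2 t ≤ fieldWidth n W) :
    (((8 + m' + t) * fieldWidth n W + ((s + 1) / 2 + Nat.clog 2 t) : ℕ) : ℝ) ≤
      1 / 2 * n * Real.logb 2 (2 * (W : ℝ) + 1) + 1000000000 * excess n W := by
  have h1 := three_halves_le_logb hn
  have h2 := half_le_logb_logb hn
  have h3 := logb_nonneg_of_one_le hW
  have h4 := one_le_logb_base hW
  have hn' : (3 : ℝ) ≤ n := by exact_mod_cast hn
  have hW' : (1 : ℝ) ≤ W := by exact_mod_cast hW
  have hQ := div_logb_le_excess hn hW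
  obtain ⟨y, hy1, hyn, hy⟩ := exists_root (n := n) (by omega)
  have hWy : 2 * (W : ℝ) + 1 ≤ y := by
    refine le_of_pow_le_pow_left₀ (n := 16) (by norm_num) (by linarith) ?_
    rw [hyn]
    exact_mod_cast h
  have hWn : (W : ℝ) ≤ n := by
    have : y ≤ y ^ 16 := le_self_pow₀ hy1 (by norm_num)
    linarith
  have hωℓ : Real.logb 2 (W : ℝ) ≤ Real.logb 2 n :=
    Real.logb_le_logb_of_le (by norm_num) (by linarith) hWn
  have hL := fieldWidth_le hn hW
  rw [logb_mul_natCast hn hW] at hL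
  generalize fieldWidth n W = L at *
  -- the block parameter
  have hgB : Real.logb 2 n ≤ 8 * g * Real.logb 2 (2 * (W : ℝ) + 1) := by
    have h5 : n ≤ ((2 * W + 1) ^ 4) ^ (g + 1) := by
      rw [hg]
      exact (Nat.lt_pow_succ_log_self (Nat.one_lt_pow (by norm_num) (by omega)) n).le
    have h6 : (n : ℝ) ≤ (2 * (W : ℝ) + 1) ^ (4 * (g + 1)) := by
      rw [pow_mul]; exact_mod_cast h5
    have h7 := Real.logb_le_logb_of_le (b := 2) (by norm_num) (by linarith) h6
    rw [Real.logb_pow] at h7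
    push_cast at h7
    have hg1' : (1 : ℝ) ≤ g := by exact_mod_cast hg1
    nlinarith
  have hpow : ((2 * (W : ℝ) + 1) ^ (2 * g)) ≤ y ^ 8 := by
    refine le_of_pow_le_pow_left₀ (n := 2) (by norm_num) (by positivity) ?_
    rw [← pow_mul, ← pow_mul, hyn, show 2 * g * 2 = 4 * g by ring, pow_mul]
    have := Nat.pow_log_le_self ((2 * W + 1) ^ 4) (show n ≠ 0 by omega)
    rw [← hg] at this
    exact_mod_cast this
  have hg'le : (g' : ℝ) ≤ 4 * Real.logb 2 n ^ 2 := by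
    have := natLog_le_logb (x := n)
    have h0 : (0 : ℝ) ≤ Nat.log 2 n := by positivity
    rw [hg']
    push_cast
    nlinarith
  have hg'ge : Real.logb 2 n ^ 2 ≤ g' := by
    have h5 : (n : ℝ) ≤ 2 ^ (Nat.log 2 n + 1) := by
      exact_mod_cast (Nat.lt_pow_succ_log_self (by norm_num) n).le
    have h6 := Real.logb_le_logb_of_le (b := 2) (by norm_num) (by linarith) h5
    rw [Real.logb_pow, Real.logb_self_eq_one (by norm_num), mul_one] at h6
    rw [hg']
    push_cast at h6 ⊢
    exact pow_le_pow_left₀ (by linarith) h6 2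
  have hR1 : 2 * (R : ℝ) + 1 ≤ 36 * Real.logb 2 n ^ 2 * W := by
    rw [hR]
    push_cast
    nlinarith [mul_le_mul_of_nonneg_right hg'le (show (0 : ℝ) ≤ W by linarith),
      mul_le_mul h1 h1 (by norm_num) (by linarith)]
  have hlogR : 1 + Real.logb 2 (2 * (R : ℝ) + 1) ≤
      16 * (Real.logb 2 W + Real.logb 2 (Real.logb 2 n)) := by
    have h5 := Real.logb_le_logb_of_le (b := 2) (by norm_num) (by positivity) hR1
    rw [Real.logb_mul (by positivity) (by positivity), Real.logb_mul (by norm_num) (by positivity),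
      Real.logb_pow] at h5
    have h6 : Real.logb 2 36 ≤ 6 := by
      rw [Real.logb_le_iff_le_rpow (by norm_num) (by norm_num)]; norm_num
    push_cast at h5
    linarith
  have hm1 : (m : ℝ) * g ≤ n + g := by exact_mod_cast hm
  have hm1' : (m' : ℝ) * g' ≤ n + g' := by exact_mod_cast hm'
  have hg1' : (1 : ℝ) ≤ g := by exact_mod_cast hg1
  have hgn : (g : ℝ) ≤ n := by
    have : g ≤ n := by rw [hg]; exact Nat.log_le_self _ _
    exact_mod_cast this
  have htR : (t : ℝ) ≤ 36 * Real.logb 2 n ^ 2 * W * y ^ 8 := by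
    rw [ht]
    push_cast
    exact mul_le_mul hR1 hpow (by positivity) (by positivity)
  have hmB : (m : ℝ) * (1 + Real.logb 2 (2 * (R : ℝ) + 1)) ≤ 256 * excess n W := by
    have hexc : excess n W = (n : ℝ) / Real.logb 2 n * Real.logb 2 (2 * (W : ℝ) + 1) *
      (Real.logb 2 W + Real.logb 2 (Real.logb 2 n)) := rfl
    have h5 : (m : ℝ) ≤ 16 * ((n : ℝ) / Real.logb 2 n * Real.logb 2 (2 * (W : ℝ) + 1)) := by
      rw [div_mul_eq_mul_div, mul_div_assoc', le_div_iff₀ (by linarith)]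
      calc (m : ℝ) * Real.logb 2 n ≤ m * (8 * g * Real.logb 2 (2 * (W : ℝ) + 1)) :=
            mul_le_mul_of_nonneg_left hgB (by positivity)
        _ = 8 * (m * g) * Real.logb 2 (2 * (W : ℝ) + 1) := by ring
        _ ≤ 8 * (2 * n) * Real.logb 2 (2 * (W : ℝ) + 1) :=
            mul_le_mul_of_nonneg_right (by linarith) (by linarith)
        _ = 16 * (n * Real.logb 2 (2 * (W : ℝ) + 1)) := by ring
    calc (m : ℝ) * (1 + Real.logb 2 (2 * (R : ℝ) + 1)) ≤
          16 * ((n : ℝ) / Real.logb 2 n * Real.logb 2 (2 * (W : ℝ) + 1)) *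
            (16 * (Real.logb 2 W + Real.logb 2 (Real.logb 2 n))) :=
          mul_le_mul h5 hlogR (by
            have : 0 ≤ Real.logb 2 (2 * (R : ℝ) + 1) := Real.logb_nonneg (by norm_num) (by
              have : (0 : ℝ) ≤ R := by positivity
              linarith)
            linarith) (by positivity)
      _ = 256 * excess n W := by rw [hexc]; ring
  have hclog : (Nat.clog 2 t : ℝ) ≤ L := by exact_mod_cast htL
  have hhalf : (((s + 1) / 2 : ℕ) : ℝ) ≤ (s + 1) / 2 := by
    have := Nat.cast_div_le (α := ℝ) (m := s + 1) (n := 2)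
    push_cast at this
    exact this
  push_cast
  generalize Nat.clog 2 t = c at *
  set ℓ := Real.logb 2 (n : ℝ)
  set E := excess n W
  have hLℓ : (L : ℝ) ≤ 64 * ℓ := by linarith
  have hℓn : ℓ ≤ 256 * (n / ℓ) := by
    rw [mul_div_assoc', le_div_iff₀ (by linarith)]
    have h5 : ℓ * ℓ ≤ (16 * y) * (16 * y) := mul_le_mul hy hy (by linarith) (by linarith)
    have h6 : y ^ 2 ≤ y ^ 16 := pow_le_pow_right₀ hy1 (by norm_num)
    rw [hyn] at h6
    nlinarith
  have hm'L : (m' : ℝ) * (64 * ℓ) ≤ 64 * (n / ℓ) + 64 * ℓ := by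
    have hpos : 0 < (g' : ℝ) := lt_of_lt_of_le (by positivity) hg'ge
    have h5 : (m' : ℝ) ≤ n / ℓ ^ 2 + 1 := by
      have h6 : (m' : ℝ) ≤ n / g' + 1 := by
        rw [← sub_le_iff_le_add, le_div_iff₀ hpos]
        linarith
      have h7 : (n : ℝ) / g' ≤ n / ℓ ^ 2 :=
        div_le_div_of_nonneg_left (by linarith) (by positivity) hg'ge
      linarith
    calc (m' : ℝ) * (64 * ℓ) ≤ (n / ℓ ^ 2 + 1) * (64 * ℓ) :=
          mul_le_mul_of_nonneg_right h5 (by linarith)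
      _ = 64 * (n / ℓ) + 64 * ℓ := by
          have : ℓ ≠ 0 := by linarith
          field_simp
  have htL' : (t : ℝ) * (64 * ℓ) ≤ 150994944 * (n / ℓ) := by
    rw [mul_div_assoc', le_div_iff₀ (by linarith)]
    have h5 : ℓ ^ 4 ≤ (16 * y) ^ 4 := pow_le_pow_left₀ (by linarith) hy 4
    have h6 : y ^ 13 ≤ y ^ 16 := pow_le_pow_right₀ hy1 (by norm_num)
    have hWy' : (W : ℝ) ≤ y := by linarith
    calc (t : ℝ) * (64 * ℓ) * ℓ ≤ (36 * ℓ ^ 2 * W * y ^ 8) * (64 * ℓ) * ℓ := by gcongr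
      _ = 2304 * ℓ ^ 4 * (W * y ^ 8) := by ring
      _ ≤ 2304 * (16 * y) ^ 4 * (y * y ^ 8) := by gcongr
      _ = 150994944 * y ^ 13 := by ring
      _ ≤ 150994944 * n := by rw [← hyn]; linarith
  have hsum : (8 + (m' : ℝ) + t) * L ≤ (8 + m' + t) * (64 * ℓ) :=
    mul_le_mul_of_nonneg_left hLℓ (by positivity)
  linarith

end Estimates

/-! ### The main result -/

lemma exists_short_labels {n W : ℕ} (hn : 3 ≤ n) (hW : 1 ≤ W) {G : SimpleGraph (Fin n)}
    {wt : Sym2 (Fin n) → ℕ} (hG : G.Connected) (hwt : ∀ e ∈ G.edgeSet, wt e ≤ W) :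
    ∃ label : Fin n → Label,
      (∀ x, ((label x).length : ℝ) ≤
        1 / 2 * n * Real.logb 2 (2 * (W : ℝ) + 1) + 1000000000 * excess n W) ∧
      ∀ w : ℕ, 4 * fieldWidth n W ≤ w → ∀ x y,
        Decodes Formula.query.program Formula.query.program.length w (label x) (label y)
          (wdist G wt x y) := by
  have hnL := mul_lt_pow_fieldWidth hn hW
  have hL1 := one_le_fieldWidth n W
  rcases lt_or_ge n ((2 * W + 1) ^ 16) with h | h
  · obtain ⟨label, h1, h2⟩ := exists_labels_of_table hG hwt (table_size_le hn hW) hnL hL1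
    refine ⟨label, fun x => ?_, h2⟩
    rw [h1]
    have := table_estimate hn hW h
    have := one_le_logb_base hW
    have : 0 ≤ 1 / 2 * n * Real.logb 2 (2 * (W : ℝ) + 1) := by positivity
    linarith
  · set g := Nat.log ((2 * W + 1) ^ 4) n with hg
    set g' := (Nat.log 2 n + 1) ^ 2 with hg'
    have hb4 : 2 ≤ (2 * W + 1) ^ 4 := Nat.one_lt_pow (by norm_num) (by omega)
    have hg1 : 1 ≤ g := Nat.log_pos hb4
      ((Nat.pow_le_pow_right (by omega) (by norm_num)).trans h)
    have hgg : g ≤ g' := by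
      have h1 : g ≤ Nat.log 2 n := Nat.log_anti_left (by norm_num) hb4
      nlinarith
    obtain ⟨R, hR⟩ : ∃ R, R = 4 * g' * W := ⟨_, rfl⟩
    obtain ⟨t, ht⟩ : ∃ t, t = (2 * R + 1) * (2 * W + 1) ^ (2 * g) := ⟨_, rfl⟩
    obtain ⟨m, m', N, hm, hm', hNt, hsum, hlabels⟩ :=
      exists_labels_of_clusters (by omega) hG hwt hg1 hgg hR ht
    have hcount : ∀ {a b : ℕ}, 1 ≤ b → a * b ≤ n + b → a ≤ n + 1 := by
      intro a b hb hab
      refine Nat.le_of_mul_le_mul_right (hab.trans ?_) hb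
      rw [Nat.succ_mul]
      exact Nat.add_le_add_right (Nat.le_mul_of_pos_right n hb) b
    have htn : t ≤ 9 * (n * W) ^ 4 := by
      have h1 : (2 * W + 1) ^ (2 * g) ≤ n := by
        refine le_trans ?_ (Nat.pow_log_le_self ((2 * W + 1) ^ 4) (show n ≠ 0 by omega))
        rw [← pow_mul]
        exact Nat.pow_le_pow_right (by omega) (by omega)
      have h2 : g' ≤ n ^ 2 := Nat.pow_le_pow_left (Nat.log_lt_self 2 (by omega)) 2
      have h3 : 2 * R + 1 ≤ 9 * (n ^ 2 * W) := by
        have h4 : 1 ≤ n ^ 2 * W := Nat.mul_pos (by positivity) hW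
        have h5 := Nat.mul_le_mul_right W h2
        have h6 : 4 * g' * W = 4 * (g' * W) := mul_assoc _ _ _
        omega
      calc t ≤ 9 * (n ^ 2 * W) * n := by rw [ht]; exact Nat.mul_le_mul h3 h1
        _ = 9 * (n ^ 3 * W ^ 1) := by ring
        _ ≤ 9 * (n ^ 4 * W ^ 4) := Nat.mul_le_mul_left _ (Nat.mul_le_mul
            (Nat.pow_le_pow_right (by omega) (by norm_num))
            (Nat.pow_le_pow_right hW (by norm_num)))
        _ = 9 * (n * W) ^ 4 := by ring
    have hs : ∑ j ∈ Finset.range m, Nat.clog 2 (N j) ≤ m * t := by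
      have := Finset.sum_le_card_nsmul (Finset.range m) (fun j => Nat.clog 2 (N j)) t fun j _ =>
        (Nat.clog_le_of_le_pow Nat.lt_two_pow_self.le).trans (hNt j)
      simpa using this
    have hsize := cluster_size_le hn hW (hcount hg1 hm) (hcount (hg1.trans hgg) hm') htn hs
    obtain ⟨label, h1, h2⟩ := hlabels _ _ _ rfl rfl hsize hnL hL1
    have htL : Nat.clog 2 t ≤ fieldWidth n W := by
      apply Nat.clog_le_of_le_pow
      have := Nat.le_mul_of_pos_right (8 + m' + t) hL1
      omega
    refine ⟨label, fun x => ?_, h2⟩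
    rw [h1]
    exact cluster_estimate hn hW h hg hg1 hg' hR ht hm hm' hsum htL

lemma four_mul_fieldWidth_le {n W w : ℕ} (hn : 3 ≤ n) (hW : 1 ≤ W)
    (h : ((128 : ℕ) : ℝ) * Real.logb 2 ((n : ℝ) * W) ≤ w) : 4 * fieldWidth n W ≤ w := by
  have := fieldWidth_le hn hW
  push_cast at h
  have h' : ((4 * fieldWidth n W : ℕ) : ℝ) ≤ w := by
    push_cast
    linarith
  exact_mod_cast h'

lemma excess_one_isLittleO : (fun n : ℕ => excess n 1) =o[Filter.atTop] fun n : ℕ => (n : ℝ) := by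
  have hlog : Filter.Tendsto (fun n : ℕ => Real.logb 2 n) Filter.atTop Filter.atTop :=
    (Real.tendsto_logb_atTop (by norm_num)).comp tendsto_natCast_atTop_atTop
  have h1 : (fun x : ℝ => Real.logb 2 x) =o[Filter.atTop] fun x : ℝ => x := by
    have := Real.isLittleO_log_id_atTop.const_mul_left (Real.log 2)⁻¹
    refine this.congr_left fun x => ?_
    rw [Real.logb, div_eq_inv_mul]
  have h2 := (Asymptotics.isBigO_refl (fun n : ℕ => (n : ℝ) / Real.logb 2 n * Real.logb 2 3)
    Filter.atTop).mul_isLittleO (h1.comp_tendsto hlog)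
  have h3 : (fun n : ℕ => (n : ℝ) / Real.logb 2 n * Real.logb 2 3 * Real.logb 2 n)
      =O[Filter.atTop] fun n : ℕ => (n : ℝ) := by
    refine Asymptotics.IsBigO.of_bound (Real.logb 2 3) ?_
    filter_upwards [hlog.eventually_gt_atTop 0] with n hn
    have h3 : 0 ≤ Real.logb 2 3 := Real.logb_nonneg (by norm_num) (by norm_num)
    rw [mul_right_comm, div_mul_cancel₀ _ hn.ne', norm_mul, Real.norm_of_nonneg h3, mul_comm]
  refine (h2.trans_isBigO h3).congr_left fun n => ?_
  simp only [excess, Function.comp, Nat.cast_one, Real.logb_one, zero_add]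
  norm_num

end DistLabel

theorem mainTheorem1 :
    -- one decoding program `P`, running for at most `T` steps on words of at least
    -- `K * log (n * W)` bits, serves all graphs and all `n` and `W`
    ∃ (P : DistLabel.Program) (T K : ℕ),
      (∃ C : ℝ, ∀ n W : ℕ, 3 ≤ n → 1 ≤ W →
        ∀ (G : SimpleGraph (Fin n)) (wt : Sym2 (Fin n) → ℕ), G.Connected →
          (∀ e ∈ G.edgeSet, 1 ≤ wt e ∧ wt e ≤ W) →
          ∃ label : Fin n → DistLabel.Label,
            (∀ x, ((label x).length : ℝ) ≤
              1 / 2 * (n : ℝ) * Real.logb 2 (2 * (W : ℝ) + 1) +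
                C * ((n : ℝ) / Real.logb 2 n * Real.logb 2 (2 * (W : ℝ) + 1) *
                  (Real.logb 2 W + Real.logb 2 (Real.logb 2 n)))) ∧
            ∀ w : ℕ, (K : ℝ) * Real.logb 2 ((n : ℝ) * (W : ℝ)) ≤ (w : ℝ) →
              ∀ x y, DistLabel.Decodes P T w (label x) (label y) (DistLabel.wdist G wt x y)) ∧
      -- the unweighted case
      (∃ err : ℕ → ℝ, err =o[Filter.atTop] (fun n : ℕ => (n : ℝ)) ∧
        ∀ n : ℕ, 3 ≤ n → ∀ G : SimpleGraph (Fin n), G.Connected →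
          ∃ label : Fin n → DistLabel.Label,
            (∀ x, ((label x).length : ℝ) ≤ Real.logb 2 3 / 2 * (n : ℝ) + err n) ∧
            ∀ w : ℕ, (K : ℝ) * Real.logb 2 (n : ℝ) ≤ (w : ℝ) →
              ∀ x y, DistLabel.Decodes P T w (label x) (label y) (G.dist x y)) := by
  refine ⟨DistLabel.Formula.query.program, DistLabel.Formula.query.program.length, 128,
    ⟨1000000000, fun n W hn hW G wt hG hwt => ?_⟩,
    fun n => 1000000000 * DistLabel.excess n 1,
    DistLabel.excess_one_isLittleO.const_mul_left _, fun n hn G hG => ?_⟩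
  · obtain ⟨label, h1, h2⟩ :=
      DistLabel.exists_short_labels hn hW hG fun e he => (hwt e he).2
    exact ⟨label, h1, fun w hw => h2 w (DistLabel.four_mul_fieldWidth_le hn hW hw)⟩
  · obtain ⟨label, h1, h2⟩ := DistLabel.exists_short_labels hn le_rfl (wt := fun _ => 1) hG
      fun _ _ => le_rfl
    refine ⟨label, fun x => (h1 x).trans_eq ?_, fun w hw x y => ?_⟩
    · have : (2 * ((1 : ℕ) : ℝ) + 1) = 3 := by norm_num
      rw [this]
      ring
    · rw [← DistLabel.wdist_one hG]
      refine h2 w (DistLabel.four_mul_fieldWidth_le hn le_rfl ?_) x y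
      rwa [Nat.cast_one, mul_one]
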